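/- Let $d\ge 1$, $k\ge 2$, let $\vec w^1,\dots,\vec w^k\in\mathbb N^d$ be vectors of positive integers with $\gcd(w^1_i,\dots,w^k_i)=1$ for every $i=1,\dots,d$, and let $p_1,\dots,p_k>0$ satisfy $\sum_{j=1}^k p_j=1$. For $\vec u\in\mathbb N^d$ put $R_{\vec u}=\prod_{i=1}^d[0,u_i-1]\cap\mathbb Z^d$. Consider $k+1$ dominoes: the small dominoes $\tau^j$ of shape $R_{\vec w^j}$, $1\le j\le k$, and the large domino $\tau^P$ of shape $R_{\vec W}$, where $W_i=\prod_{j=1}^k w^j_i$ and we write $\vec w^P=\vec W$. Let $\mathcal A=\{\tau^t_{\vec v}: t\in\{1,\dots,k,P\},\ \vec v\in R_{\vec w^t}\}$, where $\tau^t_{\vec v}$ stands for the cell at position $\vec v$ of the domino $\tau^t$, and let $Y=Y(\vec w^1,\dots,\vec w^k)\subset\mathcal A^{\mathbb Z^d}$ be the domino tiling shift, i.e. the set of codings of tilings by these dominoes with vertices in $\mathbb Z^d$: $y\in Y$ if and only if, whenever $y[\vec u]=\tau^t_{\vec v}$, one has $y[\vec u-\vec v+\vec v\,']=\tau^t_{\vec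 v\,'}$ for all $\vec v\,'\in R_{\vec w^t}$. Then for every free, measure-preserving action $T$ of $\mathbb Z^d$ on a Lebesgue probability space $(X,\mathcal M,\mu)$ there is a measurable partition $\phi:X\to\mathcal A$ such that for $\mu$-a.e. $x\in X$ there is a point $y_x\in Y$ with $$\phi(T^{\vec v}x)=y_x[\vec v]\qquad\text{for all }\vec v\in\mathbb Z^d,$$ such that for every $j=1,\dots,k$ $$\mu(\phi^{-1}(\tau^j))<\min_{i=1,\dots,k}p_i ,$$ and such that $\mu(\phi^{-1}(\tau^P))>1-\min_{i=1,\dots,k}p_i$. Here $\phi^{-1}(\tau^t)=\phi^{-1}(\{\tau^t_{\vec v}:\vec v\in R_{\vec w^t}\})$. -/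

import Mathlib

open MeasureTheory

/-- A measure space whose underlying space is a *Lebesgue space*: up to a null set, its
σ-algebra lies between a standard Borel σ-algebra and the completion of that σ-algebra.
Standard Borel spaces and their completions are included. -/
def IsLebesgueSpace {X : Type*} [m : MeasurableSpace X] (μ : Measure X) : Prop :=
  ∃ B : MeasurableSpace X, B ≤ m ∧
    ∃ S : Set X, MeasurableSet[B] S ∧ μ Sᶜ = 0 ∧
      @StandardBorelSpace S (B.comap Subtype.val) ∧
      ∀ s : Set X, MeasurableSet[m] s → ∃ t : Set X, MeasurableSet[B] t ∧ s =ᵐ[μ] t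

/-- The rectangle `R_u = ∏ᵢ [0, uᵢ - 1] ∩ ℤ` in `ℤ^d`. -/
def rectangle {d : ℕ} (u : Fin d → ℕ) : Set (Fin d → ℤ) :=
  {v | ∀ i, 0 ≤ v i ∧ v i < u i}

/-- The side lengths of the `k + 1` dominoes attached to `w¹, …, wᵏ`: the domino `some j` is the
small domino `τʲ`, with sides `wʲ`; the domino `none` is the large domino `τᴾ`, whose side in
direction `i` is `Wᵢ = ∏ⱼ wʲᵢ`. -/
def dominoSides {d k : ℕ} (w : Fin k → Fin d → ℕ) : Option (Fin k) → Fin d → ℕ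
  | some j => w j
  | none => fun i => ∏ j, w j i

/-- The alphabet of the domino tiling shift: the symbol `⟨t, v⟩` is `τᵗ_v`, the cell at
position `v` of the domino `τᵗ`. -/
def DominoAlphabet {d k : ℕ} (w : Fin k → Fin d → ℕ) : Type :=
  Σ t : Option (Fin k), rectangle (dominoSides w t)

/-- The domino tiling shift `Y(w¹, …, wᵏ)`, the set of symbolic codings of tilings by the `k + 1`
dominoes: if `y` shows the symbol `τᵗ_v` at position `u`, then the whole symbolic domino `τᵗ`
occurs in `y` with its origin at position `u - v`. -/
def dominoShift {d k : ℕ} (w : Fin k → Fin d → ℕ) : Set ((Fin d → ℤ) → DominoAlphabet w) :=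
  {y | ∀ (u : Fin d → ℤ) (t : Option (Fin k)) (v : rectangle (dominoSides w t)), y u = ⟨t, v⟩ →
    ∀ v' : rectangle (dominoSides w t), y (u - v + v') = ⟨t, v'⟩}

/-! The tiling is a limit along Rokhlin towers with growing cubes. The first coding uses the large
domino only, placed on the grid of its sides in each cube. On passing to the next tower, an old cube
lying well inside a new one keeps the tiling of its inner part, and the rest of the new cube is
filled by its own grid of large dominoes. The two grids are out of phase, and small dominoes repair
this: around the kept part a frame is inserted whose outer boundary is aligned with the new grid. A
frame splits into slabs. Since the sides `w j i` have gcd 1 in each direction, a slab that is thick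
enough can be cut into layers of thicknesses `w j i`, each tiled by one kind of small domino
(`isTileable_frame`, `IsCodingOnTower.refine`).

Frames need only bounded width, so the towers can be chosen such that the points outside the cubes
or too near their boundaries have measures with sum below the least `p i`
(`exists_towerBase_inner`). Symbols change only at such points. By Borel–Cantelli almost every
symbol changes finitely often, so the limit codes a tiling, and a point that is never bad still
carries the large domino. -/

theorem dominoSides_pos {d k : ℕ} {w : Fin k → Fin d → ℕ} (hw : ∀ j i, 0 < w j i)
    (t : Option (Fin k)) (i : Fin d) : 0 < dominoSides w t i := by
  cases t with
  | none => exact Finset.prod_pos fun j _ => hw j i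
  | some j => exact hw j i

/-- A common multiple of all side lengths of all dominoes. -/
def commonSide {d k : ℕ} (w : Fin k → Fin d → ℕ) : ℕ := ∏ i, ∏ j, w j i

theorem commonSide_pos {d k : ℕ} {w : Fin k → Fin d → ℕ} (hw : ∀ j i, 0 < w j i) :
    0 < commonSide w :=
  Finset.prod_pos fun i _ => Finset.prod_pos fun j _ => hw j i

theorem dominoSides_dvd_commonSide {d k : ℕ} (w : Fin k → Fin d → ℕ) (t : Option (Fin k))
    (i : Fin d) : dominoSides w t i ∣ commonSide w := by
  have h : (∏ j, w j i) ∣ commonSide w :=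
    Finset.dvd_prod_of_mem (fun i => ∏ j, w j i) (Finset.mem_univ i)
  cases t with
  | none => exact h
  | some j => exact (Finset.dvd_prod_of_mem (fun j => w j i) (Finset.mem_univ j)).trans h

/-- The symbol at position `q` of the tiling of `ℤ^d` by the translates of the domino `t` in the
lattice spanned by its sides. -/
def gridSymbol {d k : ℕ} {w : Fin k → Fin d → ℕ} (hw : ∀ j i, 0 < w j i) (t : Option (Fin k))
    (q : Fin d → ℤ) : DominoAlphabet w :=
  ⟨t, fun i => q i % dominoSides w t i, fun i =>
    ⟨Int.emod_nonneg _ (by have := dominoSides_pos hw t i; omega),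
      Int.emod_lt_of_pos _ (by have := dominoSides_pos hw t i; omega)⟩⟩

theorem gridSymbol_eq_iff {d k : ℕ} {w : Fin k → Fin d → ℕ} (hw : ∀ j i, 0 < w j i)
    (t : Option (Fin k)) (q : Fin d → ℤ) (t' : Option (Fin k))
    (v : rectangle (dominoSides w t')) :
    gridSymbol hw t q = ⟨t', v⟩ ↔
      t = t' ∧ ∀ i, q i % dominoSides w t' i = (v : Fin d → ℤ) i := by
  constructor
  · intro h
    unfold gridSymbol at h
    cases h
    exact ⟨rfl, fun i => rfl⟩
  · rintro ⟨rfl, h⟩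
    unfold gridSymbol
    congr 1
    apply Subtype.ext
    funext i
    exact h i

/-! ### Tilings of boxes and frames -/

/-- The rectangle `∏ᵢ [aᵢ, bᵢ)` in `ℤ^d`. -/
def latticeBox {d : ℕ} (a b : Fin d → ℤ) : Set (Fin d → ℤ) :=
  {u | ∀ i, a i ≤ u i ∧ u i < b i}

/-- On the set `D` the configuration `g` is a disjoint union of whole dominoes. -/
def IsTilingOn {d k : ℕ} {w : Fin k → Fin d → ℕ} (g : (Fin d → ℤ) → DominoAlphabet w)
    (D : Set (Fin d → ℤ)) : Prop :=
  ∀ u ∈ D, ∀ (t : Option (Fin k)) (v : rectangle (dominoSides w t)), g u = ⟨t, v⟩ →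
    ∀ v' : rectangle (dominoSides w t), u - v + v' ∈ D ∧ g (u - v + v') = ⟨t, v'⟩

/-- The set `D` can be tiled by dominoes. -/
def IsTileable {d k : ℕ} (w : Fin k → Fin d → ℕ) (D : Set (Fin d → ℤ)) : Prop :=
  ∃ g : (Fin d → ℤ) → DominoAlphabet w, IsTilingOn g D

theorem isTileable_empty {d k : ℕ} {w : Fin k → Fin d → ℕ} (hw : ∀ j i, 0 < w j i) :
    IsTileable w ∅ :=
  ⟨gridSymbol hw none, fun _ hu => hu.elim⟩

theorem IsTileable.union {d k : ℕ} {w : Fin k → Fin d → ℕ} {D E : Set (Fin d → ℤ)}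
    (hD : IsTileable w D) (hE : IsTileable w E) (h : Disjoint D E) : IsTileable w (D ∪ E) := by
  classical
  obtain ⟨g, hg⟩ := hD
  obtain ⟨f, hf⟩ := hE
  refine ⟨D.piecewise g f, ?_⟩
  rintro u (hu | hu) t v huv v'
  · rw [Set.piecewise_eq_of_mem _ _ _ hu] at huv
    obtain ⟨h1, h2⟩ := hg u hu t v huv v'
    exact ⟨Or.inl h1, by rw [Set.piecewise_eq_of_mem _ _ _ h1, h2]⟩
  · rw [Set.piecewise_eq_of_notMem _ _ _ (h.notMem_of_mem_right hu)] at huv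
    obtain ⟨h1, h2⟩ := hf u hu t v huv v'
    exact ⟨Or.inr h1,
      by rw [Set.piecewise_eq_of_notMem _ _ _ (h.notMem_of_mem_right h1), h2]⟩

/-- One coordinate of the fact that an interval whose length is a multiple of `s` is a union of
whole grid cells. -/
theorem emod_sub_add_mem {x n s v v' : ℤ} (hsn : s ∣ n) (hx : 0 ≤ x) (hxn : x < n)
    (hv : x % s = v) (hv' : 0 ≤ v') (hvs : v' < s) : 0 ≤ x - v + v' ∧ x - v + v' < n := by
  obtain ⟨m, rfl⟩ := hsn
  have hs : 0 < s := by omega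
  have h1 := Int.emod_add_mul_ediv x s
  have h2 : 0 ≤ x / s := Int.ediv_nonneg hx hs.le
  have h3 : x / s < m := by
    apply Int.ediv_lt_of_lt_mul hs
    rw [mul_comm]; exact hxn
  have h4 : 0 ≤ s * (x / s) := by positivity
  have h5 : s * (x / s + 1) ≤ s * m := by
    apply mul_le_mul_of_nonneg_left _ hs.le
    omega
  rw [mul_add] at h5
  constructor <;> omega

theorem emod_sub_add_emod {x s v v' : ℤ} (hv : x % s = v) (hv' : 0 ≤ v') (hvs : v' < s) :
    (x - v + v') % s = v' := by
  have h1 := Int.emod_add_mul_ediv x s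
  have : x - v + v' = v' + s * (x / s) := by omega
  rw [this, Int.add_mul_emod_self_left, Int.emod_eq_of_lt hv' hvs]

theorem isTileable_latticeBox {d k : ℕ} {w : Fin k → Fin d → ℕ} (hw : ∀ j i, 0 < w j i)
    (t : Option (Fin k)) (a b : Fin d → ℤ) (h : ∀ i, (dominoSides w t i : ℤ) ∣ b i - a i) :
    IsTileable w (latticeBox a b) := by
  refine ⟨fun u => gridSymbol hw t (u - a), ?_⟩
  intro u hu t' v huv v'
  obtain ⟨rfl, hv⟩ := (gridSymbol_eq_iff hw _ _ _ _).1 huv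
  refine ⟨fun i => ?_, (gridSymbol_eq_iff hw _ _ _ _).2 ⟨rfl, fun i => ?_⟩⟩
  · have h1 := emod_sub_add_mem (h i) (x := (u - a) i) (by have := hu i; simp; omega)
      (by have := hu i; simp; omega) (hv i) (v'.2 i).1 (v'.2 i).2
    simp only [Pi.sub_apply, Pi.add_apply] at h1 ⊢
    omega
  · have h1 := emod_sub_add_emod (x := (u - a) i) (hv i) (v'.2 i).1 (v'.2 i).2
    rw [← h1]
    congr 1
    simp only [Pi.sub_apply, Pi.add_apply]
    ring

theorem latticeBox_update_union {d : ℕ} (a b : Fin d → ℤ) (i : Fin d) (c : ℤ) (h1 : a i ≤ c)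
    (h2 : c ≤ b i) :
    latticeBox a b =
      latticeBox a (Function.update b i c) ∪ latticeBox (Function.update a i c) b := by
  ext u
  constructor
  · intro hu
    rcases lt_or_ge (u i) c with h | h
    · left
      intro l
      rcases eq_or_ne l i with rfl | hl
      · simpa using ⟨(hu l).1, h⟩
      · simpa [hl] using hu l
    · right
      intro l
      rcases eq_or_ne l i with rfl | hl
      · simpa using ⟨h, (hu l).2⟩
      · simpa [hl] using hu l
  · rintro (hu | hu) l <;> have := hu l <;> rcases eq_or_ne l i with rfl | hl <;>
      simp_all <;> omega

theorem disjoint_latticeBox {d : ℕ} {a b a' b' : Fin d → ℤ} (i : Fin d) (h : b i ≤ a' i) :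
    Disjoint (latticeBox a b) (latticeBox a' b') :=
  Set.disjoint_left.2 fun _ hu hu' => by have := hu i; have := hu' i; omega

/-- Writing the thickness as a sum of sides `w j i` cuts the slab into layers. A layer of thickness
`w j i` is a grid of dominoes `some j`, because the remaining sides are multiples of every domino
side. -/
theorem isTileable_slab {d k : ℕ} {w : Fin k → Fin d → ℕ} (hw : ∀ j i, 0 < w j i) (i : Fin d)
    {n : ℕ} (hn : n ∈ AddSubmonoid.closure (Set.range fun j => w j i)) (a b : Fin d → ℤ)
    (hi : b i - a i = n) (hl : ∀ l ≠ i, (commonSide w : ℤ) ∣ b l - a l) :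
    IsTileable w (latticeBox a b) := by
  induction hn using AddSubmonoid.closure_induction generalizing a b with
  | mem n hn =>
    obtain ⟨j, rfl⟩ := hn
    refine isTileable_latticeBox hw (some j) a b fun l => ?_
    rcases eq_or_ne l i with rfl | hli
    · rw [hi]; exact dvd_rfl
    · exact (Int.natCast_dvd_natCast.2 (dominoSides_dvd_commonSide w (some j) l)).trans (hl l hli)
  | zero =>
    convert isTileable_empty hw
    rw [Set.eq_empty_iff_forall_notMem]
    intro u hu
    have := hu i
    push_cast at hi
    omega
  | add n m _ _ ihn ihm =>
    push_cast at hi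
    rw [latticeBox_update_union a b i (a i + n) (by omega) (by omega)]
    refine IsTileable.union (ihn _ _ (by simp) fun l hli => by simpa [hli] using hl l hli)
      (ihm _ _ (by simp; omega) fun l hli => by simpa [hli] using hl l hli)
      (disjoint_latticeBox i (by simp))

/-- The Frobenius coin problem in each coordinate; the sum of the bounds serves all coordinates at
once. -/
theorem exists_forall_ge_mem_closure {d k : ℕ} (w : Fin k → Fin d → ℕ)
    (hgcd : ∀ i, Finset.univ.gcd (fun j => w j i) = 1) :
    ∃ K : ℕ, ∀ n ≥ K, ∀ i, n ∈ AddSubmonoid.closure (Set.range fun j => w j i) := by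
  have h : ∀ i, ∃ K : ℕ, ∀ n ≥ K, n ∈ AddSubmonoid.closure (Set.range fun j => w j i) := by
    intro i
    obtain ⟨K, hK⟩ := Nat.exists_mem_closure_of_ge (Set.range fun j => w j i)
    refine ⟨K, fun n hn => hK n hn ?_⟩
    have : Nat.setGcd (Set.range fun j => w j i) ∣ 1 := by
      rw [← hgcd i]
      exact Finset.dvd_gcd fun j _ => Nat.setGcd_dvd_of_mem ⟨j, rfl⟩
    exact this.trans (one_dvd n)
  choose K hK using h
  exact ⟨∑ i, K i, fun n hn i =>
    hK i n ((Finset.single_le_sum (fun _ _ => Nat.zero_le _) (Finset.mem_univ i)).trans hn)⟩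

/-- The inner box is enlarged to the outer one in one direction at a time. Each enlargement adds two
slabs of thickness at least `K`, whose other sides are multiples of `commonSide w`. -/
theorem isTileable_frame {d k : ℕ} {w : Fin k → Fin d → ℕ} (hw : ∀ j i, 0 < w j i) {K : ℕ}
    (hK : ∀ n ≥ K, ∀ i, n ∈ AddSubmonoid.closure (Set.range fun j => w j i))
    (a b A B : Fin d → ℤ) (hab : ∀ i, a i ≤ b i) (ha : ∀ i, A i + K ≤ a i)
    (hb : ∀ i, b i + K ≤ B i) (hd : ∀ i, (commonSide w : ℤ) ∣ b i - a i)
    (hD : ∀ i, (commonSide w : ℤ) ∣ B i - A i) :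
    IsTileable w (latticeBox A B \ latticeBox a b) := by
  classical
  -- `s` is the set of directions in which the box has already been enlarged.
  suffices h : ∀ s : Finset (Fin d),
      IsTileable w (latticeBox (s.piecewise A a) (s.piecewise B b) \ latticeBox a b) by
    simpa using h Finset.univ
  intro s
  induction s using Finset.induction_on with
  | empty => simpa using isTileable_empty hw
  | insert i s hi ih =>
    rw [Finset.piecewise_insert, Finset.piecewise_insert]
    set α := s.piecewise A a with hα
    set β := s.piecewise B b with hβ
    have hαi : α i = a i := by simp [hα, hi]
    have hβi : β i = b i := by simp [hβ, hi]
    have hαβ : ∀ l ≠ i, (commonSide w : ℤ) ∣ β l - α l := by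
      intro l _
      by_cases hl : l ∈ s <;> simp [hα, hβ, hl, hd, hD]
    have h1 := ha i
    have h2 := hab i
    have h3 := hb i
    have hbox : latticeBox (Function.update α i (A i)) (Function.update β i (B i)) =
        latticeBox (Function.update α i (A i)) (Function.update β i (a i)) ∪
          (latticeBox α β ∪ latticeBox (Function.update α i (b i)) (Function.update β i (B i))) := by
      rw [latticeBox_update_union _ (Function.update β i (B i)) i (a i) (by simp; omega)
          (by simp; omega),
        latticeBox_update_union (Function.update (Function.update α i (A i)) i (a i)) _ i (b i)
          (by simp; omega) (by simp; omega)]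
      simp only [Function.update_idem]
      rw [← hαi, ← hβi, Function.update_eq_self, Function.update_eq_self]
    have hdlow : Disjoint (latticeBox (Function.update α i (A i)) (Function.update β i (a i)))
        (latticeBox a b) := disjoint_latticeBox i (by simp)
    have hdhigh : Disjoint (latticeBox (Function.update α i (b i)) (Function.update β i (B i)))
        (latticeBox a b) := (disjoint_latticeBox i (by simp)).symm
    rw [hbox, Set.union_sdiff_distrib, Set.union_sdiff_distrib, hdlow.sdiff_eq_left,
      hdhigh.sdiff_eq_left]
    refine IsTileable.union ?_ (IsTileable.union ih ?_ ?_) ?_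
    · exact isTileable_slab hw i (hK (a i - A i).toNat (by omega) i) _ _ (by simp; omega)
        fun l hl => by simpa [hl] using hαβ l hl
    · exact isTileable_slab hw i (hK (B i - b i).toNat (by omega) i) _ _ (by simp; omega)
        fun l hl => by simpa [hl] using hαβ l hl
    · exact (disjoint_latticeBox i (by simp [hβi])).mono_left Set.sdiff_subset
    · refine Disjoint.union_right
        (Disjoint.mono_right Set.sdiff_subset (disjoint_latticeBox i (by simp [hαi])))
        (disjoint_latticeBox i (by simpa using h2))

/-! ### Rokhlin's lemma for `ℤ^d` -/

section Rokhlin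

theorem IsLebesgueSpace.exists_separating_on {X : Type*} [m : MeasurableSpace X] {μ : Measure X}
    (hμ : IsLebesgueSpace μ) :
    ∃ S : Set X, μ Sᶜ = 0 ∧ ∃ C : ℕ → Set X, (∀ n, MeasurableSet (C n)) ∧
      ∀ x ∈ S, ∀ y ∈ S, (∀ n, x ∈ C n ↔ y ∈ C n) → x = y := by
  obtain ⟨B, hB, S, -, hS0, hstd, -⟩ := hμ
  have hsep : @MeasurableSpace.CountablySeparated S (m.comap Subtype.val) := by
    have : @MeasurableSpace.CountablySeparated S (B.comap Subtype.val) := inferInstance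
    exact this.mono (MeasurableSpace.comap_mono hB)
  have hsep' := (@MeasurableSpace.CountablySeparated.subtype_iff X m S).1 hsep
  exact ⟨S, hS0, exists_seq_separating X (p := MeasurableSet[m])
    (@MeasurableSet.univ X m) S⟩

/-- On a Lebesgue space, countably many measurable sets separate almost every point from all the
other points of its orbit. -/
theorem IsLebesgueSpace.exists_separating_seq {d : ℕ} {X : Type*} [MeasurableSpace X]
    {μ : Measure X} (hμ : IsLebesgueSpace μ) [AddAction (Fin d → ℤ) X]
    (hT : ∀ v : Fin d → ℤ, MeasurePreserving (fun x : X => v +ᵥ x) μ μ)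
    (hfree : ∀ v : Fin d → ℤ, v ≠ 0 → ∀ᵐ x ∂μ, v +ᵥ x ≠ x) :
    ∃ D : ℕ → Set X, (∀ n, MeasurableSet (D n)) ∧
      ∀ᵐ x ∂μ, ∀ v : Fin d → ℤ, v ≠ 0 → ∃ n, x ∈ D n ∧ v +ᵥ x ∉ D n := by
  obtain ⟨S, hS0, C, hC, hCsep⟩ := hμ.exists_separating_on
  -- Interleaving the sets with their complements makes separation one-sided: the separating set can
  -- be taken to contain `x`.
  refine ⟨fun n => if n % 2 = 0 then C (n / 2) else (C (n / 2))ᶜ, fun n => ?_, ?_⟩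
  · beta_reduce
    split_ifs
    exacts [hC _, (hC _).compl]
  · have hmem : ∀ᵐ x ∂μ, ∀ v : Fin d → ℤ, v +ᵥ x ∈ S :=
      ae_all_iff.2 fun v => (hT v).quasiMeasurePreserving.ae hS0
    have hne : ∀ᵐ x ∂μ, ∀ v : Fin d → ℤ, v ≠ 0 → v +ᵥ x ≠ x := by
      rw [ae_all_iff]
      intro v
      rcases eq_or_ne v 0 with rfl | hv
      · simp
      · simpa [hv] using hfree v hv
    filter_upwards [hmem, hne] with x hx hxne v hv
    by_contra! h
    refine hxne v hv (hCsep _ (hx v) _ (by simpa using hx 0) fun n => ?_)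
    have h0 := h (2 * n)
    have h1 := h (2 * n + 1)
    have e1 : (2 * n + 1) / 2 = n := by omega
    have e2 : ¬ (2 * n + 1) % 2 = 0 := by omega
    simp only [Nat.mul_mod_right, if_true, Nat.mul_div_cancel_left n two_pos] at h0
    rw [if_neg e2, e1] at h1
    exact ⟨fun h' => by_contra fun h'' => h1 h'' h', h0⟩

/-- The cube `[0, L)^d` in `ℤ^d`. -/
noncomputable def latticeCube (d L : ℕ) : Finset (Fin d → ℤ) := Fintype.piFinset fun _ => Finset.Ico 0 (L : ℤ)

theorem mem_latticeCube {d L : ℕ} {u : Fin d → ℤ} :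
    u ∈ latticeCube d L ↔ ∀ i, 0 ≤ u i ∧ u i < L := by
  simp [latticeCube]

theorem card_latticeCube (d L : ℕ) : (latticeCube d L).card = L ^ d := by
  simp [latticeCube]

/-- The translates of `B` by the vectors of the cube `[0, L)^d` are pairwise disjoint. -/
def IsTowerBase (d L : ℕ) {X : Type*} [AddAction (Fin d → ℤ) X] (B : Set X) : Prop :=
  ∀ x ∈ B, ∀ v : Fin d → ℤ, (∀ i, |v i| < L) → v +ᵥ x ∈ B → v = 0

/-- The union of the translates of `B` by the vectors of the cube `[0, L)^d`. -/
def towerSet (d L : ℕ) {X : Type*} [AddAction (Fin d → ℤ) X] (B : Set X) : Set X :=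
  {x | ∃ u ∈ latticeCube d L, -u +ᵥ x ∈ B}

theorem IsTowerBase.eq {d L : ℕ} {X : Type*} [AddAction (Fin d → ℤ) X] {B : Set X} (hB : IsTowerBase d L B) {x : X} {u u' : Fin d → ℤ}
    (hu : u ∈ latticeCube d L) (hu' : u' ∈ latticeCube d L) (h : -u +ᵥ x ∈ B)
    (h' : -u' +ᵥ x ∈ B) : u = u' := by
  rw [mem_latticeCube] at hu hu'
  have := hB _ h (u - u') (fun i => by
    have := hu i
    have := hu' i
    rw [abs_lt, Pi.sub_apply]
    omega) (by rwa [vadd_vadd, sub_add_eq_add_sub, add_neg_cancel, zero_sub])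
  exact sub_eq_zero.1 this

variable {d : ℕ} {X : Type*} [MeasurableSpace X] {μ : Measure X} [AddAction (Fin d → ℤ) X]

/-- Choosing one separating index for each vector of `F` determines a set disjoint from its
`F`-translates. Since `F` is finite there are countably many choices, and almost every point admits
one. -/
theorem exists_countable_cover_disjoint_translates
    (hT : ∀ v : Fin d → ℤ, MeasurePreserving (fun x : X => v +ᵥ x) μ μ)
    {D : ℕ → Set X} (hD : ∀ n, MeasurableSet (D n))
    (hsep : ∀ᵐ x ∂μ, ∀ v : Fin d → ℤ, v ≠ 0 → ∃ n, x ∈ D n ∧ v +ᵥ x ∉ D n)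
    {F : Finset (Fin d → ℤ)} (hF : 0 ∉ F) :
    ∃ A : ℕ → Set X, (∀ n, MeasurableSet (A n)) ∧
      (∀ n, ∀ x ∈ A n, ∀ v ∈ F, v +ᵥ x ∉ A n) ∧ ∀ᵐ x ∂μ, ∃ n, x ∈ A n := by
  obtain ⟨e, he⟩ := exists_surjective_nat (F → ℕ)
  refine ⟨fun n => ⋂ v : F, (D (e n v) ∩ (fun x => (v : Fin d → ℤ) +ᵥ x) ⁻¹' (D (e n v))ᶜ),
    fun n => ?_, fun n x hx v hv hvx => ?_, ?_⟩
  · exact MeasurableSet.iInter fun v => (hD _).inter ((hT v).measurable (hD _).compl)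
  · rw [Set.mem_iInter] at hx hvx
    exact (hx ⟨v, hv⟩).2 (hvx ⟨v, hv⟩).1
  · filter_upwards [hsep] with x hx
    choose f hf using fun v : F => hx v fun h => hF (h ▸ v.2)
    obtain ⟨n, rfl⟩ := he f
    exact ⟨n, Set.mem_iInter.2 hf⟩

/-- Greedy construction: at stage `n` the points of `A n ∩ G` with no `F`-translate in the current
set are added. A point of `A n ∩ G` is thus either added or already has a translate in the set. -/
theorem exists_maximal_separated_subset
    (hT : ∀ v : Fin d → ℤ, MeasurePreserving (fun x : X => v +ᵥ x) μ μ)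
    {D : ℕ → Set X} (hD : ∀ n, MeasurableSet (D n))
    (hsep : ∀ᵐ x ∂μ, ∀ v : Fin d → ℤ, v ≠ 0 → ∃ n, x ∈ D n ∧ v +ᵥ x ∉ D n)
    {F : Finset (Fin d → ℤ)} (hF : 0 ∉ F) (hFneg : ∀ v ∈ F, -v ∈ F)
    {G : Set X} (hG : MeasurableSet G) :
    ∃ C ⊆ G, MeasurableSet C ∧ (∀ x ∈ C, ∀ v ∈ F, v +ᵥ x ∉ C) ∧
      ∀ᵐ x ∂μ, x ∈ G → x ∈ C ∨ ∃ v ∈ F, v +ᵥ x ∈ C := by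
  obtain ⟨A, hA, hAF, hAc⟩ := exists_countable_cover_disjoint_translates hT hD hsep hF
  let next (n : ℕ) (C : Set X) : Set X :=
    C ∪ (A n ∩ G ∩ ⋂ v ∈ F, (fun x => v +ᵥ x) ⁻¹' Cᶜ)
  let C : ℕ → Set X := fun n => Nat.rec ∅ next n
  have hC : ∀ n, C (n + 1) = C n ∪ (A n ∩ G ∩ ⋂ v ∈ F, (fun x => v +ᵥ x) ⁻¹' (C n)ᶜ) :=
    fun n => rfl
  have hmono : Monotone C := monotone_nat_of_le_succ fun n => by
    rw [hC]; exact Set.subset_union_left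
  have hCG : ∀ n, C n ⊆ G := by
    intro n
    induction n with
    | zero => exact Set.empty_subset _
    | succ n ih => rw [hC]; exact Set.union_subset ih fun x hx => hx.1.2
  have hCm : ∀ n, MeasurableSet (C n) := by
    intro n
    induction n with
    | zero => exact MeasurableSet.empty
    | succ n ih =>
      rw [hC]
      exact ih.union (((hA n).inter hG).inter
        (Finset.measurableSet_biInter F fun v _ => (hT v).measurable ih.compl))
  have hCF : ∀ n, ∀ x ∈ C n, ∀ v ∈ F, v +ᵥ x ∉ C n := by
    intro n
    induction n with
    | zero => exact fun x hx => hx.elim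
    | succ n ih =>
      rw [hC]
      rintro x (hx | hx) v hv (hvx | hvx)
      · exact ih x hx v hv hvx
      -- An old point moved to a new one: the symmetry of `F` turns this into a new point moved to
      -- an old one.
      · have := Set.mem_iInter₂.1 hvx.2 (-v) (hFneg v hv)
        rw [Set.mem_preimage, neg_vadd_vadd] at this
        exact this hx
      · exact Set.mem_iInter₂.1 hx.2 v hv hvx
      · exact hAF n x hx.1.1 v hv hvx.1.1
  refine ⟨⋃ n, C n, Set.iUnion_subset hCG, MeasurableSet.iUnion hCm, ?_, ?_⟩
  · intro x hx v hv hvx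
    obtain ⟨n, hn⟩ := Set.mem_iUnion.1 hx
    obtain ⟨m, hm⟩ := Set.mem_iUnion.1 hvx
    exact hCF (max n m) x (hmono (le_max_left n m) hn) v hv (hmono (le_max_right n m) hm)
  · filter_upwards [hAc] with x ⟨n, hn⟩ hxG
    rcases Classical.em (∃ v ∈ F, (v +ᵥ x : X) ∈ C n) with ⟨v, hv, hvx⟩ | h
    · exact Or.inr ⟨v, hv, Set.mem_iUnion.2 ⟨n, hvx⟩⟩
    · left
      push Not at h
      refine Set.mem_iUnion.2 ⟨n + 1, ?_⟩
      rw [hC]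
      exact Or.inr ⟨⟨hn, hxG⟩, Set.mem_iInter₂.2 h⟩

theorem measurableSet_tower (hT : ∀ v : Fin d → ℤ, MeasurePreserving (fun x : X => v +ᵥ x) μ μ)
    {B : Set X} (hB : MeasurableSet B) (F : Set (Fin d → ℤ)) :
    MeasurableSet {x : X | ∃ u ∈ F, -u +ᵥ x ∈ B} := by
  have : {x : X | ∃ u ∈ F, -u +ᵥ x ∈ B} = ⋃ u ∈ F, (fun x => -u +ᵥ x) ⁻¹' B := by
    ext; simp
  rw [this]
  exact MeasurableSet.biUnion F.to_countable fun u _ => (hT _).measurable hB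

theorem measurableSet_towerSet
    (hT : ∀ v : Fin d → ℤ, MeasurePreserving (fun x : X => v +ᵥ x) μ μ)
    {B : Set X} (hB : MeasurableSet B) (L : ℕ) : MeasurableSet (towerSet d L B) :=
  measurableSet_tower hT hB (latticeCube d L : Set (Fin d → ℤ))

theorem measureReal_vadd_preimage
    (hT : ∀ v : Fin d → ℤ, MeasurePreserving (fun x : X => v +ᵥ x) μ μ)
    {B : Set X} (hB : MeasurableSet B) (v : Fin d → ℤ) :
    μ.real ((fun x => v +ᵥ x) ⁻¹' B) = μ.real B :=
  (hT v).measureReal_preimage hB.nullMeasurableSet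

theorem measureReal_towerSet [IsFiniteMeasure μ]
    (hT : ∀ v : Fin d → ℤ, MeasurePreserving (fun x : X => v +ᵥ x) μ μ)
    {B : Set X} (hB : MeasurableSet B) {L : ℕ} (hBL : IsTowerBase d L B) :
    μ.real (towerSet d L B) = (L : ℝ) ^ d * μ.real B := by
  have : towerSet d L B = ⋃ u ∈ latticeCube d L, (fun x => -u +ᵥ x) ⁻¹' B := by
    ext; simp [towerSet]
  rw [this, measureReal_biUnion_finset]
  · simp [measureReal_vadd_preimage hT hB, card_latticeCube]
  · intro u hu u' hu' hne
    exact Set.disjoint_left.2 fun x hx hx' => hne (hBL.eq hu hu' hx hx')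
  · exact fun u _ => (hT _).measurable hB

/-- The points of a tower whose level has `i`-th coordinate less than `M`. -/
theorem measureReal_lower_edge_le [IsProbabilityMeasure μ]
    (hT : ∀ v : Fin d → ℤ, MeasurePreserving (fun x : X => v +ᵥ x) μ μ)
    {B : Set X} (hB : MeasurableSet B) {L M K : ℕ} (hBL : IsTowerBase d L B) (hL : M * K ≤ L)
    (i : Fin d) :
    K * μ.real {x | ∃ u ∈ {u | u ∈ latticeCube d L ∧ u i < M}, -u +ᵥ x ∈ B} ≤ 1 := by
  set S := {x | ∃ u ∈ {u | u ∈ latticeCube d L ∧ u i < M}, -u +ᵥ x ∈ B} with hS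
  have hSm : MeasurableSet S := measurableSet_tower hT hB _
  -- The edge layer has thickness `M`, so `K` disjoint translates of it in direction `i` fit into
  -- the tower.
  let c (j : ℕ) : Fin d → ℤ := Pi.single i ((j * M : ℕ) : ℤ)
  have hmem : ∀ j < K, ∀ u ∈ latticeCube d L, u i < M → u + c j ∈ latticeCube d L := by
    intro j hj u hu hui
    rw [mem_latticeCube] at hu ⊢
    intro l
    have := hu l
    rcases eq_or_ne l i with rfl | hl
    · have h1 : (j + 1) * M ≤ K * M := Nat.mul_le_mul_right M hj
      rw [add_mul, mul_comm K, one_mul] at h1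
      simp only [c, Pi.add_apply, Pi.single_eq_same]
      omega
    · simpa [c, hl] using this
  have hdisj : Set.PairwiseDisjoint (Finset.range K : Set ℕ)
      fun j => (fun x : X => -c j +ᵥ x) ⁻¹' S := by
    intro j hj j' hj' hne
    refine Set.disjoint_left.2 ?_
    rintro x ⟨u, ⟨hu, hui⟩, hux⟩ ⟨u', ⟨hu', hui'⟩, hux'⟩
    rw [vadd_vadd, ← neg_add] at hux hux'
    have h := congrFun (hBL.eq (hmem j (by simpa using hj) u hu hui)
      (hmem j' (by simpa using hj') u' hu' hui') hux hux') i
    simp only [c, Pi.add_apply, Pi.single_eq_same] at h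
    have h0 := (mem_latticeCube.1 hu i).1
    have h0' := (mem_latticeCube.1 hu' i).1
    rcases lt_or_gt_of_ne hne with hlt | hlt
    · have h1 : (j + 1) * M ≤ j' * M := Nat.mul_le_mul_right M hlt
      rw [add_mul, one_mul] at h1
      omega
    · have h1 : (j' + 1) * M ≤ j * M := Nat.mul_le_mul_right M hlt
      rw [add_mul, one_mul] at h1
      omega
  have h := measureReal_biUnion_finset (μ := μ) hdisj fun j _ => (hT (-c j)).measurable hSm
  simp only [measureReal_vadd_preimage hT hSm, Finset.sum_const, Finset.card_range,
    nsmul_eq_mul] at h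
  rw [← h]
  exact measureReal_le_one

/-- Lowering levels by `L - M` in direction `i` carries the upper edge into the lower one. -/
theorem measureReal_upper_edge_le [IsProbabilityMeasure μ]
    (hT : ∀ v : Fin d → ℤ, MeasurePreserving (fun x : X => v +ᵥ x) μ μ)
    {B : Set X} (hB : MeasurableSet B) {L M K : ℕ} (hBL : IsTowerBase d L B) (hL : M * K ≤ L)
    (hML : M ≤ L) (i : Fin d) :
    K * μ.real {x | ∃ u ∈ {u | u ∈ latticeCube d L ∧ (L : ℤ) - M ≤ u i}, -u +ᵥ x ∈ B} ≤ 1 := by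
  refine le_trans ?_ (measureReal_lower_edge_le hT hB hBL hL i)
  refine mul_le_mul_of_nonneg_left ?_ (Nat.cast_nonneg K)
  rw [← measureReal_vadd_preimage hT (measurableSet_tower hT hB {u | u ∈ latticeCube d L ∧ u i < M})
    (-Pi.single i ((L - M : ℕ) : ℤ))]
  refine measureReal_mono ?_
  rintro x ⟨u, ⟨hu, hui⟩, hux⟩
  refine ⟨u - Pi.single i ((L - M : ℕ) : ℤ), ⟨?_, ?_⟩, ?_⟩
  · rw [mem_latticeCube] at hu ⊢
    intro l
    have := hu l
    rcases eq_or_ne l i with rfl | hl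
    · simp only [Pi.sub_apply, Pi.single_eq_same]
      omega
    · simpa [hl] using this
  · have := (mem_latticeCube.1 hu i).2
    simp only [Pi.sub_apply, Pi.single_eq_same]
    omega
  · rw [vadd_vadd]
    convert hux using 2
    abel

/-- Cutting the cubes of a tower into smaller cubes. -/
theorem IsTowerBase.subdivide {L K : ℕ} (hL : 0 < L)
    (hT : ∀ v : Fin d → ℤ, MeasurePreserving (fun x : X => v +ᵥ x) μ μ)
    {B : Set X} (hB : MeasurableSet B) (hBL : IsTowerBase d (L * K) B) :
    ∃ C, MeasurableSet C ∧ IsTowerBase d L C ∧ towerSet d L C = towerSet d (L * K) B := by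
  have hL' : (0 : ℤ) < L := by exact_mod_cast hL
  refine ⟨{x | ∃ u ∈ {u | u ∈ latticeCube d (L * K) ∧ ∀ i, (L : ℤ) ∣ u i}, -u +ᵥ x ∈ B},
    measurableSet_tower hT hB _, ?_, ?_⟩
  · rintro x ⟨u, ⟨hu, hud⟩, hux⟩ v hv ⟨u', ⟨hu', hud'⟩, hux'⟩
    rw [mem_latticeCube] at hu hu'
    -- Levels divisible by `L` are at most `L * K - L`, so this vector is short enough for the large
    -- tower and the two base points coincide. Then `v = u' - u` is a multiple of `L` with entries
    -- below `L`.
    have h0 := hBL _ hux (-u' + v + u) (fun i => by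
      obtain ⟨m, hm⟩ := hud i
      obtain ⟨m', hm'⟩ := hud' i
      have h1 := hu i
      have h2 := hu' i
      have h3 := abs_lt.1 (hv i)
      have key : ∀ {m : ℤ}, (L : ℤ) * m < (L * K : ℕ) → (L : ℤ) * m + L ≤ (L * K : ℕ) := by
        intro m hm
        push_cast at hm ⊢
        have h4 : (L : ℤ) * (m + 1) ≤ L * K :=
          mul_le_mul_of_nonneg_left (lt_of_mul_lt_mul_left hm hL'.le) hL'.le
        linarith
      have h4 := key (hm ▸ h1.2)
      have h5 := key (hm' ▸ h2.2)
      rw [abs_lt]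
      simp only [Pi.add_apply, Pi.neg_apply]
      constructor <;> omega)
      (by rwa [vadd_vadd, add_assoc, add_neg_cancel, add_zero, ← vadd_vadd])
    funext i
    have h1 := congrFun h0 i
    simp only [Pi.add_apply, Pi.neg_apply, Pi.zero_apply] at h1
    refine Int.eq_zero_of_abs_lt_dvd ?_ (hv i)
    have : v i = u' i - u i := by linarith
    exact this ▸ dvd_sub (hud' i) (hud i)
  · ext x
    constructor
    · rintro ⟨a, ha, u, ⟨hu, hud⟩, hux⟩
      refine ⟨u + a, ?_, ?_⟩
      · rw [mem_latticeCube] at *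
        intro i
        have h1 := ha i
        have h2 := hu i
        obtain ⟨m, hm⟩ := hud i
        simp only [Pi.add_apply]
        refine ⟨by omega, ?_⟩
        have h3 : m < K := by
          have : (L : ℤ) * m < L * K := by push_cast at h2; omega
          exact lt_of_mul_lt_mul_left this hL'.le
        have h4 : (L : ℤ) * (m + 1) ≤ L * K := mul_le_mul_of_nonneg_left h3 hL'.le
        push_cast
        rw [mul_add] at h4
        omega
      · rwa [vadd_vadd, ← neg_add] at hux
    · rintro ⟨u, hu, hux⟩
      rw [mem_latticeCube] at hu
      refine ⟨fun i => u i % L, mem_latticeCube.2 fun i =>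
        ⟨Int.emod_nonneg _ hL'.ne', Int.emod_lt_of_pos _ hL'⟩, fun i => u i - u i % L,
        ⟨mem_latticeCube.2 fun i => ?_, fun i => Int.dvd_self_sub_emod⟩, ?_⟩
      · have h1 := hu i
        have h2 := Int.emod_lt_of_pos (u i) hL'
        have h3 := Int.emod_nonneg (u i) hL'.ne'
        have h4 : 0 ≤ L * (u i / L) := mul_nonneg hL'.le (Int.ediv_nonneg h1.1 hL'.le)
        have h5 := Int.emod_add_mul_ediv (u i) L
        omega
      · rw [vadd_vadd, ← neg_add]
        have : ((fun i => u i - u i % L) + fun i => u i % L) = u := by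
          funext i
          simp
        rwa [this]

/-- A point outside a tower can be moved into the tower by a short vector only if it lands close
to the boundary of a cube. -/
theorem measureReal_vadd_mem_towerSet_le [IsProbabilityMeasure μ]
    (hT : ∀ v : Fin d → ℤ, MeasurePreserving (fun x : X => v +ᵥ x) μ μ)
    {B : Set X} (hB : MeasurableSet B) {L K : ℕ} (hK : 0 < K) (hBL : IsTowerBase d (L * K) B) :
    μ.real ({x | ∃ v ∈ latticeCube d L, v +ᵥ x ∈ towerSet d (L * K) B} \ towerSet d (L * K) B) ≤
      (L : ℝ) ^ d * d / K := by
  let E (i : Fin d) : Set X :=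
    {x | ∃ u ∈ {u | u ∈ latticeCube d (L * K) ∧ u i < L}, -u +ᵥ x ∈ B}
  have hE : ∀ i, MeasurableSet (E i) := fun i => measurableSet_tower hT hB _
  have hEle : ∀ i, μ.real (E i) ≤ 1 / K := fun i => by
    rw [le_div_iff₀' (by exact_mod_cast hK)]
    exact measureReal_lower_edge_le hT hB hBL le_rfl i
  have hsub : {x | ∃ v ∈ latticeCube d L, v +ᵥ x ∈ towerSet d (L * K) B} \ towerSet d (L * K) B ⊆
      ⋃ v ∈ latticeCube d L, ⋃ i ∈ Finset.univ, (fun x => v +ᵥ x) ⁻¹' E i := by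
    rintro x ⟨⟨v, hv, u, hu, hux⟩, hx⟩
    simp only [Set.mem_iUnion]
    refine ⟨v, hv, ?_⟩
    by_contra! h
    have hui : ∀ i, (L : ℤ) ≤ u i := fun i => by
      by_contra! hi
      exact h i (Finset.mem_univ i) ⟨u, ⟨hu, hi⟩, hux⟩
    refine hx ⟨u - v, ?_, ?_⟩
    · rw [mem_latticeCube] at *
      intro i
      have h1 := hu i
      have h2 := hv i
      have h3 := hui i
      simp only [Pi.sub_apply]
      omega
    · rw [vadd_vadd] at hux
      convert hux using 2
      abel
  calc μ.real _ ≤ _ := measureReal_mono hsub (measure_ne_top _ _)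
    _ ≤ ∑ v ∈ latticeCube d L, μ.real (⋃ i ∈ Finset.univ, (fun x => v +ᵥ x) ⁻¹' E i) :=
        measureReal_biUnion_finset_le _ _
    _ ≤ ∑ v ∈ latticeCube d L, ∑ i : Fin d, μ.real ((fun x => v +ᵥ x) ⁻¹' E i) :=
        Finset.sum_le_sum fun v _ => measureReal_biUnion_finset_le _ _
    _ ≤ ∑ v ∈ latticeCube d L, ∑ i : Fin d, (1 / K : ℝ) :=
        Finset.sum_le_sum fun v _ => Finset.sum_le_sum fun i _ => by
          rw [measureReal_vadd_preimage hT (hE i)]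
          exact hEle i
    _ = (L : ℝ) ^ d * d / K := by
        simp [card_latticeCube]
        ring

/-- By maximality the translates of `C` by the at most `(2L)^d` vectors with entries below `L` in
absolute value cover `G`, while the tower consists of `L^d` disjoint translates. -/
theorem exists_maximal_towerBase [IsProbabilityMeasure μ]
    (hT : ∀ v : Fin d → ℤ, MeasurePreserving (fun x : X => v +ᵥ x) μ μ)
    {D : ℕ → Set X} (hD : ∀ n, MeasurableSet (D n))
    (hsep : ∀ᵐ x ∂μ, ∀ v : Fin d → ℤ, v ≠ 0 → ∃ n, x ∈ D n ∧ v +ᵥ x ∉ D n)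
    {L : ℕ} (hL : 0 < L) {G : Set X} (hG : MeasurableSet G) :
    ∃ C ⊆ G, MeasurableSet C ∧ IsTowerBase d L C ∧
      μ.real G ≤ 2 ^ d * μ.real (towerSet d L C) := by
  let F₀ : Finset (Fin d → ℤ) := Fintype.piFinset fun _ => Finset.Ioo (-L : ℤ) L
  have hF₀ : ∀ v, v ∈ F₀ ↔ ∀ i, |v i| < L := by simp [F₀, abs_lt]
  have hcard : F₀.card ≤ (2 * L) ^ d := by
    simp only [F₀, Fintype.card_piFinset, Int.card_Ioo, Finset.prod_const, Finset.card_univ,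
      Fintype.card_fin]
    exact Nat.pow_le_pow_left (by omega) d
  obtain ⟨C, hCG, hC, hCF, hCmax⟩ := exists_maximal_separated_subset hT hD hsep
    (F := F₀.erase 0) (by simp)
    (fun v hv => by
      rw [Finset.mem_erase, hF₀] at *
      exact ⟨neg_ne_zero.2 hv.1, fun i => by simpa using hv.2 i⟩) hG
  have hbase : IsTowerBase d L C := fun x hx v hv hvx => by
    by_contra hv0
    exact hCF x hx v (Finset.mem_erase.2 ⟨hv0, (hF₀ v).2 hv⟩) hvx
  refine ⟨C, hCG, hC, hbase, ?_⟩
  have hsub : G ≤ᵐ[μ] ⋃ v ∈ F₀, (fun x => v +ᵥ x) ⁻¹' C := by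
    filter_upwards [hCmax] with x hx hxG
    refine Set.mem_iUnion₂.2 ?_
    rcases hx hxG with h | ⟨v, hv, hvx⟩
    · exact ⟨0, (hF₀ 0).2 (fun _ => by simpa using hL), by simpa using h⟩
    · exact ⟨v, Finset.mem_of_mem_erase hv, hvx⟩
  rw [measureReal_towerSet hT hC hbase]
  calc μ.real G ≤ μ.real (⋃ v ∈ F₀, (fun x => v +ᵥ x) ⁻¹' C) :=
        ENNReal.toReal_mono (measure_ne_top _ _) (measure_mono_ae hsub)
    _ ≤ ∑ v ∈ F₀, μ.real ((fun x => v +ᵥ x) ⁻¹' C) := measureReal_biUnion_finset_le _ _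
    _ = F₀.card * μ.real C := by simp [measureReal_vadd_preimage hT hC]
    _ ≤ ((2 * L) ^ d : ℕ) * μ.real C := by gcongr
    _ = 2 ^ d * ((L : ℝ) ^ d * μ.real C) := by push_cast; rw [mul_pow]; ring

/-- Each round covers at least the fraction `2⁻ᵈ` of what is left, up to a small error. The new base
must stay clear of the old tower, which costs a neighbourhood `N` of it; that neighbourhood adds
little if the old cubes are first taken `K` times larger and then subdivided. -/
theorem exists_towerBase_of_pow [IsProbabilityMeasure μ]
    (hT : ∀ v : Fin d → ℤ, MeasurePreserving (fun x : X => v +ᵥ x) μ μ)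
    {D : ℕ → Set X} (hD : ∀ n, MeasurableSet (D n))
    (hsep : ∀ᵐ x ∂μ, ∀ v : Fin d → ℤ, v ≠ 0 → ∃ n, x ∈ D n ∧ v +ᵥ x ∉ D n) (m : ℕ) :
    ∀ {L : ℕ}, 0 < L → ∀ {δ : ℝ}, 0 < δ →
      ∃ B : Set X, MeasurableSet B ∧ IsTowerBase d L B ∧
        μ.real (towerSet d L B)ᶜ ≤ (1 - (2 ^ d)⁻¹) ^ m + δ := by
  induction m with
  | zero =>
    intro L _ δ hδ
    refine ⟨∅, MeasurableSet.empty, fun x hx => hx.elim, ?_⟩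
    have := measureReal_le_one (μ := μ) (s := (towerSet d L (∅ : Set X))ᶜ)
    rw [pow_zero]
    linarith
  | succ m ih =>
    intro L hL δ hδ
    obtain ⟨K₀, hK₀⟩ := exists_nat_gt ((L : ℝ) ^ d * d / (δ / 2))
    have hK : 0 < K₀ + 1 := K₀.succ_pos
    set K := K₀ + 1 with hKdef
    have hKδ : (L : ℝ) ^ d * d / K ≤ δ / 2 := by
      rw [div_lt_iff₀ (by positivity)] at hK₀
      rw [div_le_iff₀ (by exact_mod_cast hK), hKdef]
      push_cast
      nlinarith
    obtain ⟨B', hB', hB'L, hB'μ⟩ := ih (L := L * K) (Nat.mul_pos hL hK) (half_pos hδ)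
    obtain ⟨B, hB, hBL, hBU⟩ := hB'L.subdivide hL hT hB'
    have hedge := (measureReal_vadd_mem_towerSet_le hT hB' hK hB'L).trans hKδ
    rw [← hBU] at hB'μ hedge
    set U := towerSet d L B with hU
    have hUm : MeasurableSet U := measurableSet_towerSet hT hB L
    set N := {x | ∃ v ∈ latticeCube d L, v +ᵥ x ∈ U} with hN
    have hNm : MeasurableSet N := by
      have : N = ⋃ v ∈ latticeCube d L, (fun x => v +ᵥ x) ⁻¹' U := by ext; simp [hN]
      rw [this]
      exact Finset.measurableSet_biUnion _ fun v _ => (hT v).measurable hUm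
    obtain ⟨C, hCN, hC, hCL, hCμ⟩ := exists_maximal_towerBase hT hD hsep hL hNm.compl
    have hcross : ∀ x ∈ B, ∀ v : Fin d → ℤ, (∀ i, |v i| < L) → v +ᵥ x ∉ C := by
      intro x hx v hv hvx
      -- Split `v` into positive and negative parts: adding the negative part to `v +ᵥ x` gives the
      -- positive part applied to `x`, a point of the tower over `B`.
      refine hCN hvx ⟨fun i => max (-v i) 0, mem_latticeCube.2 fun i => ?_,
        fun i => max (v i) 0, mem_latticeCube.2 fun i => ?_, ?_⟩
      · have := abs_lt.1 (hv i)
        omega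
      · have := abs_lt.1 (hv i)
        omega
      · rw [vadd_vadd, vadd_vadd]
        convert hx
        refine Eq.trans (congrArg (· +ᵥ x) ?_) (zero_vadd _ x)
        funext i
        simp only [Pi.add_apply, Pi.neg_apply, Pi.zero_apply]
        omega
    refine ⟨B ∪ C, hB.union hC, ?_, ?_⟩
    · rintro x (hx | hx) v hv (hvx | hvx)
      · exact hBL x hx v hv hvx
      · exact (hcross x hx v hv hvx).elim
      · refine (hcross _ hvx (-v) (fun i => by simpa using hv i) ?_).elim
        rwa [neg_vadd_vadd]
      · exact hCL x hx v hv hvx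
    · have hsplit : towerSet d L (B ∪ C) = U ∪ towerSet d L C := by
        ext x
        simp only [hU, towerSet, Set.mem_union, Set.mem_ofPred_eq, and_or_left, exists_or]
      have hdisj : towerSet d L C ⊆ Uᶜ := by
        rintro x ⟨u, hu, hux⟩ hxU
        exact hCN hux ⟨u, hu, by rwa [vadd_neg_vadd]⟩
      have h1 : μ.real (towerSet d L (B ∪ C))ᶜ = μ.real Uᶜ - μ.real (towerSet d L C) := by
        rw [hsplit, Set.compl_union, ← Set.sdiff_eq,
          measureReal_sdiff hdisj (measurableSet_towerSet hT hC L)]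
      have h2 : μ.real Uᶜ ≤ μ.real Nᶜ + μ.real (N \ U) := by
        refine (measureReal_mono fun x hx => ?_).trans (measureReal_union_le _ _)
        by_cases hxN : x ∈ N
        exacts [Or.inr ⟨hxN, hx⟩, Or.inl hxN]
      have h3 : 0 < ((2 : ℝ) ^ d)⁻¹ := by positivity
      have h4 : ((2 : ℝ) ^ d)⁻¹ ≤ 1 := inv_le_one_of_one_le₀ (one_le_pow₀ one_le_two)
      have h5 : ((2 : ℝ) ^ d)⁻¹ * μ.real Nᶜ ≤ μ.real (towerSet d L C) := by
        rwa [inv_mul_le_iff₀ (by positivity)]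
      rw [h1, pow_succ]
      generalize ((2 : ℝ) ^ d)⁻¹ = c at *
      have h6 : c * (μ.real Uᶜ - δ / 2) ≤ c * μ.real Nᶜ :=
        mul_le_mul_of_nonneg_left (by linarith) h3.le
      have h7 : (1 - c) * μ.real Uᶜ ≤ (1 - c) * ((1 - c) ^ m + δ / 2) :=
        mul_le_mul_of_nonneg_left hB'μ (by linarith)
      linarith

/-- **Rokhlin's lemma** for free measure-preserving actions of `ℤ^d`. -/
theorem exists_towerBase [IsProbabilityMeasure μ] (hμ : IsLebesgueSpace μ)
    (hT : ∀ v : Fin d → ℤ, MeasurePreserving (fun x : X => v +ᵥ x) μ μ)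
    (hfree : ∀ v : Fin d → ℤ, v ≠ 0 → ∀ᵐ x ∂μ, v +ᵥ x ≠ x) {L : ℕ} (hL : 0 < L) {δ : ℝ}
    (hδ : 0 < δ) :
    ∃ B : Set X, MeasurableSet B ∧ IsTowerBase d L B ∧ μ.real (towerSet d L B)ᶜ ≤ δ := by
  obtain ⟨D, hD, hsep⟩ := hμ.exists_separating_seq hT hfree
  have h3 : 0 < ((2 : ℝ) ^ d)⁻¹ := by positivity
  have h4 : ((2 : ℝ) ^ d)⁻¹ ≤ 1 := inv_le_one_of_one_le₀ (one_le_pow₀ one_le_two)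
  obtain ⟨m, hm⟩ := exists_pow_lt_of_lt_one (half_pos hδ) (sub_lt_self 1 h3)
  obtain ⟨B, hB, hBL, hBμ⟩ := exists_towerBase_of_pow hT hD hsep m hL (half_pos hδ)
  exact ⟨B, hB, hBL, by linarith⟩

/-- Rokhlin's lemma with few points close to the boundaries of the cubes. -/
theorem exists_towerBase_inner [IsProbabilityMeasure μ] (hμ : IsLebesgueSpace μ)
    (hT : ∀ v : Fin d → ℤ, MeasurePreserving (fun x : X => v +ᵥ x) μ μ)
    (hfree : ∀ v : Fin d → ℤ, v ≠ 0 → ∀ᵐ x ∂μ, v +ᵥ x ≠ x) {Q : ℕ} (hQ : 0 < Q) (M : ℕ) {δ : ℝ}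
    (hδ : 0 < δ) :
    ∃ L : ℕ, Q ∣ L ∧ 2 * M ≤ L ∧ ∃ B : Set X, MeasurableSet B ∧ IsTowerBase d L B ∧
      μ.real {x | ¬ ∃ u : Fin d → ℤ, (∀ i, M ≤ u i ∧ u i < L - M) ∧ -u +ᵥ x ∈ B} ≤ δ := by
  obtain ⟨K₀, hK₀⟩ := exists_nat_gt (2 * d / (δ / 2))
  -- The `2 * d` edge layers have measure at most `1 / K` each. The summand 2 gives `2 * M ≤ M * K ≤
  -- L`, and the factor `M + 1` in `L` keeps `L` positive when `M = 0`.
  set K := K₀ + 2 with hKdef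
  have hKpos : 0 < K := by omega
  have hKδ : (2 : ℝ) * d / K ≤ δ / 2 := by
    rw [div_lt_iff₀ (by positivity)] at hK₀
    rw [div_le_iff₀ (by exact_mod_cast hKpos), hKdef]
    push_cast
    nlinarith
  set L := Q * ((M + 1) * K) with hLdef
  have hL : 0 < L := by positivity
  have hML : M * K ≤ L :=
    (Nat.mul_le_mul_right K M.le_succ).trans (Nat.le_mul_of_pos_left _ hQ)
  have h2ML : 2 * M ≤ L := by
    refine le_trans ?_ hML
    rw [mul_comm]
    exact Nat.mul_le_mul_left M (by omega)
  obtain ⟨B, hB, hBL, hBμ⟩ := exists_towerBase hμ hT hfree hL (half_pos hδ)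
  refine ⟨L, Dvd.intro _ rfl, h2ML, B, hB, hBL, ?_⟩
  let E (i : Fin d) : Set X := {x | ∃ u ∈ {u | u ∈ latticeCube d L ∧ u i < M}, -u +ᵥ x ∈ B}
  let E' (i : Fin d) : Set X :=
    {x | ∃ u ∈ {u | u ∈ latticeCube d L ∧ (L : ℤ) - M ≤ u i}, -u +ᵥ x ∈ B}
  have hE : ∀ i, μ.real (E i ∪ E' i) ≤ 2 / K := fun i => by
    have hK' : (0 : ℝ) < K := by exact_mod_cast hKpos
    refine (measureReal_union_le _ _).trans ?_
    rw [le_div_iff₀' hK', mul_add]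
    have h1 := measureReal_lower_edge_le hT hB hBL hML i
    have h2 := measureReal_upper_edge_le hT hB hBL hML (by omega) i
    exact (add_le_add h1 h2).trans (by norm_num)
  have hsub : {x | ¬ ∃ u : Fin d → ℤ, (∀ i, M ≤ u i ∧ u i < L - M) ∧ -u +ᵥ x ∈ B} ⊆
      (towerSet d L B)ᶜ ∪ ⋃ i ∈ Finset.univ, (E i ∪ E' i) := by
    intro x hx
    by_contra h
    simp only [Set.mem_union, Set.mem_compl_iff, not_or, not_not, Set.mem_iUnion, not_exists] at h
    obtain ⟨⟨u, hu, hux⟩, h⟩ := h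
    refine hx ⟨u, fun i => ?_, hux⟩
    obtain ⟨h1, h2⟩ := h i (Finset.mem_univ i)
    constructor
    · by_contra! h3
      exact h1 ⟨u, ⟨hu, h3⟩, hux⟩
    · by_contra! h3
      exact h2 ⟨u, ⟨hu, h3⟩, hux⟩
  calc μ.real _ ≤ _ := measureReal_mono hsub
    _ ≤ μ.real (towerSet d L B)ᶜ + μ.real (⋃ i ∈ Finset.univ, (E i ∪ E' i)) :=
        measureReal_union_le _ _
    _ ≤ δ / 2 + ∑ i : Fin d, μ.real (E i ∪ E' i) :=
        add_le_add hBμ (measureReal_biUnion_finset_le _ _)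
    _ ≤ δ / 2 + ∑ i : Fin d, (2 / K : ℝ) := by
        gcongr with i
        exact hE i
    _ = δ / 2 + 2 * d / K := by
        simp
        ring
    _ ≤ δ := by linarith

end Rokhlin

/-! ### Measurability of maps into countable sets -/

theorem measurableSet_preimage_of_countable {X α β γ : Type*} [MeasurableSpace X] [Countable α]
    [Countable β] [Countable γ] {f : X → α} {g : X → β} {h : X → γ}
    (hf : ∀ a, MeasurableSet (f ⁻¹' {a})) (hg : ∀ b, MeasurableSet (g ⁻¹' {b}))
    (hh : ∀ c, MeasurableSet (h ⁻¹' {c})) (P : α → β → γ → Prop) :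
    MeasurableSet {x | P (f x) (g x) (h x)} := by
  have : {x | P (f x) (g x) (h x)} =
      ⋃ (a) (b) (c) (_ : P a b c), f ⁻¹' {a} ∩ g ⁻¹' {b} ∩ h ⁻¹' {c} := by
    ext x
    simp
  rw [this]
  exact MeasurableSet.iUnion fun a => MeasurableSet.iUnion fun b => MeasurableSet.iUnion fun c =>
    MeasurableSet.iUnion fun _ => ((hf a).inter (hg b)).inter (hh c)

/-- A sequence of measurable maps into a countable set has a measurable eventual value. -/
theorem exists_measurable_eventual_value {X α : Type*} [MeasurableSpace X] [Countable α]
    (a₀ : α) {f : ℕ → X → α} (hf : ∀ n a, MeasurableSet (f n ⁻¹' {a})) :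
    ∃ φ : X → α, (∀ a, MeasurableSet (φ ⁻¹' {a})) ∧
      ∀ x a, (∀ᶠ n in Filter.atTop, f n x = a) → φ x = a := by
  classical
  have huniq : ∀ x a b, (∀ᶠ n in Filter.atTop, f n x = a) → (∀ᶠ n in Filter.atTop, f n x = b) →
      a = b := fun x a b ha hb => by
    obtain ⟨n, h1, h2⟩ := (ha.and hb).exists
    exact h1.symm.trans h2
  let φ : X → α := fun x =>
    if h : ∃ a, ∀ᶠ n in Filter.atTop, f n x = a then h.choose else a₀
  have hφ : ∀ x a, (∀ᶠ n in Filter.atTop, f n x = a) → φ x = a := fun x a ha => by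
    have h : ∃ a, ∀ᶠ n in Filter.atTop, f n x = a := ⟨a, ha⟩
    simp only [φ, dif_pos h]
    exact huniq x _ _ h.choose_spec ha
  have hm : ∀ a, MeasurableSet {x | ∀ᶠ n in Filter.atTop, f n x = a} := fun a => by
    simp only [Filter.eventually_atTop]
    have : {x | ∃ N, ∀ n ≥ N, f n x = a} = ⋃ N, ⋂ n ≥ N, f n ⁻¹' {a} := by ext; simp
    rw [this]
    exact MeasurableSet.iUnion fun N => MeasurableSet.biInter (Set.to_countable _) fun n _ => hf n a
  refine ⟨φ, fun a => ?_, hφ⟩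
  have : φ ⁻¹' {a} = {x | ∀ᶠ n in Filter.atTop, f n x = a} ∪
      ((⋃ b, {x | ∀ᶠ n in Filter.atTop, f n x = b})ᶜ ∩ {_x | a₀ = a}) := by
    ext x
    by_cases h : ∃ b, ∀ᶠ n in Filter.atTop, f n x = b
    · obtain ⟨b, hb⟩ := h
      have h1 : x ∈ ⋃ b, {x | ∀ᶠ n in Filter.atTop, f n x = b} := Set.mem_iUnion.2 ⟨b, hb⟩
      simp only [Set.mem_preimage, Set.mem_singleton_iff, hφ x b hb, Set.mem_union,
        Set.mem_inter_iff, Set.mem_compl_iff, h1, not_true, false_and, or_false,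
        Set.mem_ofPred_eq]
      exact ⟨fun h => h ▸ hb, fun h => huniq x _ _ hb h⟩
    · have h1 : x ∉ ⋃ b, {x | ∀ᶠ n in Filter.atTop, f n x = b} := fun h' =>
        h (Set.mem_iUnion.1 h')
      have h2 : ¬ ∀ᶠ n in Filter.atTop, f n x = a := fun h' => h ⟨a, h'⟩
      have h3 : φ x = a₀ := dif_neg h
      simp only [Set.mem_preimage, Set.mem_singleton_iff, h3, Set.mem_union, Set.mem_inter_iff,
        Set.mem_compl_iff, h1, not_false_iff, true_and, Set.mem_ofPred_eq, h2, false_or]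
  rw [this]
  exact (hm a).union ((MeasurableSet.iUnion hm).compl.inter (MeasurableSet.const _))

instance DominoAlphabet.instCountable {d k : ℕ} (w : Fin k → Fin d → ℕ) :
    Countable (DominoAlphabet w) :=
  inferInstanceAs (Countable (Σ t : Option (Fin k), rectangle (dominoSides w t)))

/-! ### Tower positions and the refinement of a coding -/

open Classical in
/-- The level at which `x` lies in the tower with base `B`. -/
noncomputable def towerPos {d : ℕ} {X : Type*} [AddAction (Fin d → ℤ) X] (L : ℕ) (B : Set X)
    (x : X) : Option (Fin d → ℤ) :=
  if h : ∃ u ∈ latticeCube d L, -u +ᵥ x ∈ B then some h.choose else none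

theorem towerPos_eq_some_iff {d : ℕ} {X : Type*} [AddAction (Fin d → ℤ) X] {L : ℕ} {B : Set X}
    (hB : IsTowerBase d L B) {x : X} {u : Fin d → ℤ} :
    towerPos L B x = some u ↔ u ∈ latticeCube d L ∧ -u +ᵥ x ∈ B := by
  unfold towerPos
  split_ifs with h
  · rw [Option.some_inj]
    have hc := h.choose_spec
    exact ⟨fun e => e ▸ hc, fun hu => hB.eq hc.1 hu.1 hc.2 hu.2⟩
  · simp only [false_iff]
    exact fun hu => h ⟨u, hu⟩

theorem towerPos_vadd {d : ℕ} {X : Type*} [AddAction (Fin d → ℤ) X] {L : ℕ} {B : Set X}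
    (hB : IsTowerBase d L B) {x : X} {u : Fin d → ℤ} (h : towerPos L B x = some u)
    {v u' : Fin d → ℤ} (hu' : u' ∈ latticeCube d L) (huv : u' = u + v) :
    towerPos L B (v +ᵥ x) = some u' := by
  rw [towerPos_eq_some_iff hB] at h ⊢
  refine ⟨hu', ?_⟩
  rw [vadd_vadd]
  convert h.2 using 2
  rw [huv]
  abel

theorem towerPos_empty {d : ℕ} {X : Type*} [AddAction (Fin d → ℤ) X] (L : ℕ) (x : X) :
    towerPos (d := d) L ∅ x = none :=
  dif_neg fun ⟨_, _, h⟩ => h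

theorem measurableSet_towerPos_preimage {d : ℕ} {X : Type*} [MeasurableSpace X] {μ : Measure X}
    [AddAction (Fin d → ℤ) X]
    (hT : ∀ v : Fin d → ℤ, MeasurePreserving (fun x : X => v +ᵥ x) μ μ) {L : ℕ} {B : Set X}
    (hBm : MeasurableSet B) (hB : IsTowerBase d L B) (o : Option (Fin d → ℤ)) :
    MeasurableSet (towerPos L B ⁻¹' {o}) := by
  have hsome : ∀ u : Fin d → ℤ, MeasurableSet (towerPos L B ⁻¹' {some u}) := fun u => by
    have : towerPos L B ⁻¹' {some u} =
        {_x | u ∈ latticeCube d L} ∩ (fun x => -u +ᵥ x) ⁻¹' B := by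
      ext x
      simp [towerPos_eq_some_iff hB]
    rw [this]
    exact (MeasurableSet.const _).inter ((hT _).measurable hBm)
  cases o with
  | some u => exact hsome u
  | none =>
    have : towerPos (d := d) L B ⁻¹' {none} = (⋃ u : Fin d → ℤ, towerPos L B ⁻¹' {some u})ᶜ := by
      ext x
      simp [Option.eq_none_iff_forall_ne_some]
    rw [this]
    exact (MeasurableSet.iUnion hsome).compl

/-- The points of the cube `[0, L)^d` at distance at least `m` from its boundary. -/
def innerBox (d m L : ℕ) : Set (Fin d → ℤ) := latticeBox (fun _ => (m : ℤ)) fun _ => (L : ℤ) - m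

/-- The largest box in the cube `[0, L)^d` with sides `L - Q` whose vertices lie in
`-c + (Qℤ)^d`. -/
def alignedBox {d : ℕ} (Q L : ℕ) (c : Fin d → ℤ) : Set (Fin d → ℤ) :=
  latticeBox (fun i => -c i % Q) fun i => -c i % Q + L - Q

theorem mem_innerBox {d m L : ℕ} {u : Fin d → ℤ} :
    u ∈ innerBox d m L ↔ ∀ i, (m : ℤ) ≤ u i ∧ u i < (L : ℤ) - m := Iff.rfl

theorem mem_alignedBox {d Q L : ℕ} {c u : Fin d → ℤ} :
    u ∈ alignedBox Q L c ↔ ∀ i, -c i % Q ≤ u i ∧ u i < -c i % Q + L - Q := Iff.rfl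

/-- The point at position `u` in a cube of side `L`, which has position `c` in a cube of
side `L'`, keeps its symbol or belongs to the frame that is inserted around the small cube. -/
def IsAbsorbed {d : ℕ} (Q m L L' : ℕ) (c u : Fin d → ℤ) : Prop :=
  (∀ i, (m : ℤ) ≤ c i ∧ c i + L ≤ (L' : ℤ) - m) ∧ u ∈ alignedBox Q L c

open Classical in
/-- The symbol in the coding of a tower with cubes of side `L'` of a point at position `q`, where
`u` is its position in, and `a` its symbol in the coding of, a tower with cubes of side `L`. -/
noncomputable def refineSymbol {d k : ℕ} {w : Fin k → Fin d → ℕ} (hw : ∀ j i, 0 < w j i)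
    (g : (Fin d → ℤ) → (Fin d → ℤ) → DominoAlphabet w) (m L L' : ℕ) (a : DominoAlphabet w) :
    Option (Fin d → ℤ) → Option (Fin d → ℤ) → DominoAlphabet w
  -- Outside the new cubes no tiling is required; a symbol of the large domino makes the first
  -- coding consist of large dominoes everywhere.
  | _, none => gridSymbol hw none 0
  | none, some q => gridSymbol hw none q
  | some u, some q =>
    if IsAbsorbed (commonSide w) m L L' (q - u) u then
      if u ∈ innerBox d m L then a else g (fun i => -(q - u) i % (commonSide w : ℤ)) u
    else gridSymbol hw none q

/-- On the inner part of each cube of the tower, `φ` is the coding of a tiling by dominoes. -/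
def IsCodingOnTower {d k : ℕ} {w : Fin k → Fin d → ℕ} {X : Type*} [AddAction (Fin d → ℤ) X]
    (m L : ℕ) (B : Set X) (φ : X → DominoAlphabet w) : Prop :=
  ∀ x u, towerPos L B x = some u → u ∈ innerBox d m L →
    ∀ (t : Option (Fin k)) (v : rectangle (dominoSides w t)), φ x = ⟨t, v⟩ →
      ∀ v' : rectangle (dominoSides w t),
        u - v + v' ∈ innerBox d m L ∧ φ (((v' : Fin d → ℤ) - v) +ᵥ x) = ⟨t, v'⟩

theorem innerBox_subset_latticeCube {d m L : ℕ} {u : Fin d → ℤ} (hu : u ∈ innerBox d m L) :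
    u ∈ latticeCube d L :=
  mem_latticeCube.2 fun i => by have := mem_innerBox.1 hu i; omega

theorem alignedBox_subset_latticeCube {d Q L : ℕ} (hQ : 0 < Q) {c u : Fin d → ℤ}
    (hu : u ∈ alignedBox Q L c) : u ∈ latticeCube d L :=
  mem_latticeCube.2 fun i => by
    have h1 := mem_alignedBox.1 hu i
    have h2 := Int.emod_nonneg (-c i) (b := Q) (by omega)
    have h3 := Int.emod_lt_of_pos (-c i) (b := Q) (by omega)
    omega

theorem innerBox_subset_alignedBox {d Q m L : ℕ} (hQ : 0 < Q) (hm : Q ≤ m) {c u : Fin d → ℤ}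
    (hu : u ∈ innerBox d m L) : u ∈ alignedBox Q L c := mem_alignedBox.2 fun i => by
  have h1 := mem_innerBox.1 hu i
  have h2 := Int.emod_nonneg (-c i) (b := Q) (by omega)
  have h3 := Int.emod_lt_of_pos (-c i) (b := Q) (by omega)
  omega

theorem sub_emod_add_mem {a b s q v v' : ℤ} (ha : s ∣ a) (hb : s ∣ b) (hv : q % s = v)
    (hv' : 0 ≤ v') (hvs : v' < s) (h : a ≤ q ∧ q < b) : a ≤ q - v + v' ∧ q - v + v' < b := by
  have h1 := emod_sub_add_mem (x := q - a) (n := b - a) (v := v) (dvd_sub hb ha) (by omega)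
    (by omega) (by rw [Int.sub_emod, Int.emod_eq_zero_of_dvd ha, sub_zero, Int.emod_emod, hv])
    hv' hvs
  omega

/-- A new cube consists of kept inner boxes, frames, and a remainder on the new grid. Aligned boxes
have their vertices on that grid, as does the inner box of the new cube, so no domino crosses
between these pieces. -/
theorem IsCodingOnTower.refine {d k : ℕ} {w : Fin k → Fin d → ℕ} (hw : ∀ j i, 0 < w j i)
    {X : Type*} [AddAction (Fin d → ℤ) X] {m L L' : ℕ} {B B' : Set X}
    {φ : X → DominoAlphabet w} (hφ : IsCodingOnTower m L B φ) (hB : IsTowerBase d L B)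
    (hB' : IsTowerBase d L' B') (hmQ : commonSide w ∣ m) (hm : 0 < m) (hL : commonSide w ∣ L)
    (hL' : commonSide w ∣ L') {g : (Fin d → ℤ) → (Fin d → ℤ) → DominoAlphabet w}
    (hg : ∀ c : Fin d → ℤ, IsTilingOn (g fun i => -c i % (commonSide w : ℤ))
      (alignedBox (commonSide w) L c \ innerBox d m L)) :
    IsCodingOnTower m L' B' fun x =>
      refineSymbol hw g m L L' (φ x) (towerPos L B x) (towerPos L' B' x) := by
  set Q := commonSide w with hQdef
  have hQ : 0 < Q := commonSide_pos hw
  have hQm : Q ≤ m := Nat.le_of_dvd hm hmQ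
  have hmQ' : (Q : ℤ) ∣ m := Int.natCast_dvd_natCast.2 hmQ
  have hLQ : (Q : ℤ) ∣ L := Int.natCast_dvd_natCast.2 hL
  have hLQ' : (Q : ℤ) ∣ L' := Int.natCast_dvd_natCast.2 hL'
  intro x q hq hqi t v hxv v'
  beta_reduce at hxv
  by_cases h : ∃ u, towerPos L B x = some u ∧ IsAbsorbed Q m L L' (q - u) u
  · obtain ⟨u, hu, habs⟩ := h
    -- Both positions move by the same vector, so the offset `q - u` of the old cube, and with it
    -- absorption and the choice of frame tiling, is the same across the domino.
    have key : ∀ u', u' = u - v + v' → u' ∈ alignedBox Q L (q - u) →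
        q - v + v' ∈ innerBox d m L' ∧
          towerPos L B (((v' : Fin d → ℤ) - v) +ᵥ x) = some u' ∧
          towerPos L' B' (((v' : Fin d → ℤ) - v) +ᵥ x) = some (q - v + v') ∧
          q - v + v' - u' = q - u := by
      rintro u' rfl hu'
      have hc := alignedBox_subset_latticeCube hQ hu'
      have hin : q - v + v' ∈ innerBox d m L' := fun i => by
        have h1 := mem_latticeCube.1 hc i
        have h2 := habs.1 i
        simp only [Pi.sub_apply, Pi.add_apply] at h1 h2 ⊢
        omega
      exact ⟨hin, towerPos_vadd hB hu hc (by abel),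
        towerPos_vadd hB' hq (innerBox_subset_latticeCube hin) (by abel), by abel⟩
    by_cases hui : u ∈ innerBox d m L
    · have hxv' : φ x = ⟨t, v⟩ := by
        rw [← hxv, hu, hq]
        simp only [refineSymbol]
        rw [if_pos habs, if_pos hui]
      obtain ⟨h1, h2⟩ := hφ x u hu hui t v hxv' v'
      have h3 := innerBox_subset_alignedBox (c := q - u) hQ hQm h1
      obtain ⟨h4, h5, h6, h7⟩ := key _ rfl h3
      refine ⟨h4, ?_⟩
      beta_reduce
      rw [h5, h6]
      simp only [refineSymbol]
      rw [h7, if_pos ⟨habs.1, h3⟩, if_pos h1, h2]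
    · have hxv' : g (fun i => -(q - u) i % (Q : ℤ)) u = ⟨t, v⟩ := by
        rw [← hxv, hu, hq]
        simp only [refineSymbol]
        rw [if_pos habs, if_neg hui]
      obtain ⟨h1, h2⟩ := hg (q - u) u ⟨habs.2, hui⟩ t v hxv' v'
      obtain ⟨h4, h5, h6, h7⟩ := key _ rfl h1.1
      refine ⟨h4, ?_⟩
      beta_reduce
      rw [h5, h6]
      simp only [refineSymbol]
      rw [h7, if_pos ⟨habs.1, h1.1⟩, if_neg h1.2, h2]
  · have hxv' : gridSymbol hw none q = ⟨t, v⟩ := by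
      rw [← hxv, hq]
      rcases hu : towerPos L B x with _ | u
      · rfl
      · simp only [refineSymbol]
        rw [if_neg fun habs => h ⟨u, hu, habs⟩]
    obtain ⟨rfl, hv⟩ := (gridSymbol_eq_iff hw _ _ _ _).1 hxv'
    have hdvd : ∀ i, (dominoSides w none i : ℤ) ∣ Q := fun i =>
      Int.natCast_dvd_natCast.2 (dominoSides_dvd_commonSide w none i)
    have hin : q - v + v' ∈ innerBox d m L' := fun i =>
      sub_emod_add_mem ((hdvd i).trans hmQ') ((hdvd i).trans (dvd_sub hLQ' hmQ')) (hv i)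
        (v'.2 i).1 (v'.2 i).2 (hqi i)
    have hq' : towerPos L' B' (((v' : Fin d → ℤ) - v) +ᵥ x) = some (q - v + v') :=
      towerPos_vadd hB' hq (innerBox_subset_latticeCube hin) (by abel)
    have hgrid : gridSymbol hw none (q - v + v') = ⟨none, v'⟩ :=
      (gridSymbol_eq_iff hw _ _ _ _).2
        ⟨rfl, fun i => emod_sub_add_emod (hv i) (v'.2 i).1 (v'.2 i).2⟩
    refine ⟨hin, ?_⟩
    beta_reduce
    rw [hq', ← hgrid]
    rcases hu : towerPos L B (((v' : Fin d → ℤ) - v) +ᵥ x) with _ | u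
    · rfl
    · simp only [refineSymbol]
      refine if_neg fun habs : IsAbsorbed Q m L L'
        (q - (v : Fin d → ℤ) + (v' : Fin d → ℤ) - u) u => h ?_
      -- If one point of a large domino of the grid lay in an aligned box, the whole domino would,
      -- and `x` itself would be absorbed.
      have hbox : u + (v : Fin d → ℤ) - (v' : Fin d → ℤ) ∈ alignedBox Q L
          (q - (v : Fin d → ℤ) + (v' : Fin d → ℤ) - u) := by
        refine mem_alignedBox.2 fun i => ?_
        have h1 := mem_alignedBox.1 habs.2 i
        have h2 := Int.dvd_self_sub_emod (x := -(q - v + v' - u) i) (m := Q)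
        set r := -(q - v + v' - u) i % (Q : ℤ)
        have h3 : (Q : ℤ) ∣ (q - v + v' - u) i + r := by
          rw [← dvd_neg, neg_add']
          exact h2
        have h4 := sub_emod_add_mem (q := (q - v + v') i) (s := dominoSides w none i)
          (v := (v' : Fin d → ℤ) i) (v' := (v : Fin d → ℤ) i) ((hdvd i).trans h3)
          ((hdvd i).trans ((h3.add hLQ).sub dvd_rfl))
          (emod_sub_add_emod (hv i) (v'.2 i).1 (v'.2 i).2) (v.2 i).1 (v.2 i).2
          (by
            simp only [Pi.sub_apply, Pi.add_apply] at h1 ⊢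
            omega)
        simp only [Pi.sub_apply, Pi.add_apply] at h4 ⊢
        omega
      refine ⟨u + (v : Fin d → ℤ) - (v' : Fin d → ℤ), ?_, ?_⟩
      · have := towerPos_vadd hB hu (v := (v : Fin d → ℤ) - v')
          (alignedBox_subset_latticeCube hQ hbox) (by abel)
        rwa [vadd_vadd, sub_add_sub_cancel, sub_self, zero_vadd] at this
      · have e : q - (u + (v : Fin d → ℤ) - (v' : Fin d → ℤ)) = q - v + v' - u := by abel
        rw [e]
        exact ⟨habs.1, hbox⟩

theorem exists_frame_tilings {d k : ℕ} {w : Fin k → Fin d → ℕ} (hw : ∀ j i, 0 < w j i) {K m L : ℕ}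
    (hK : ∀ n ≥ K, ∀ i, n ∈ AddSubmonoid.closure (Set.range fun j => w j i))
    (hm : commonSide w ∣ m) (hmK : commonSide w + K ≤ m) (hL : commonSide w ∣ L)
    (hmL : 2 * m ≤ L) :
    ∃ g : (Fin d → ℤ) → (Fin d → ℤ) → DominoAlphabet w, ∀ c : Fin d → ℤ,
      IsTilingOn (g fun i => -c i % (commonSide w : ℤ))
        (alignedBox (commonSide w) L c \ innerBox d m L) := by
  have hQ := commonSide_pos hw
  set Q := commonSide w
  have hmQ : (Q : ℤ) ∣ m := Int.natCast_dvd_natCast.2 hm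
  have hLQ : (Q : ℤ) ∣ L := Int.natCast_dvd_natCast.2 hL
  have h : ∀ c : Fin d → ℤ, IsTileable w (alignedBox Q L c \ innerBox d m L) := fun c =>
    isTileable_frame hw hK _ _ _ _ (fun i => by omega)
      (fun i => by
        have := Int.emod_lt_of_pos (-c i) (b := Q) (by omega)
        omega)
      (fun i => by
        have := Int.emod_nonneg (-c i) (b := Q) (by omega)
        omega)
      (fun i => (hLQ.sub hmQ).sub hmQ)
      (fun i => by
        rw [add_sub_assoc, add_sub_cancel_left]
        exact hLQ.sub dvd_rfl)
  choose g hg using h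
  -- The aligned box depends on `c` only through the residue `r` of `-c`, and `-r` represents the
  -- same class as `c`.
  refine ⟨fun r => g (-r), fun c => ?_⟩
  have hc : alignedBox Q L c = alignedBox Q L (-fun i => -c i % (Q : ℤ)) := by
    ext u
    simp only [mem_alignedBox, Pi.neg_apply, neg_neg, Int.emod_emod]
  rw [hc]
  exact hg _

/-- A point well inside its cubes of two consecutive towers keeps its symbol. -/
theorem refineSymbol_eq_of_inner {d k : ℕ} {w : Fin k → Fin d → ℕ} (hw : ∀ j i, 0 < w j i)
    (g : (Fin d → ℤ) → (Fin d → ℤ) → DominoAlphabet w) {m L L' : ℕ} (hm : commonSide w ≤ m)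
    (a : DominoAlphabet w) {u q : Fin d → ℤ} (hu : u ∈ innerBox d m L)
    (hq : q ∈ innerBox d (m + L) L') : refineSymbol hw g m L L' a (some u) (some q) = a := by
  simp only [refineSymbol]
  rw [if_pos, if_pos hu]
  refine ⟨fun i => ?_, innerBox_subset_alignedBox (commonSide_pos hw) hm hu⟩
  have h1 := mem_innerBox.1 hu i
  have h2 := mem_innerBox.1 hq i
  push_cast at h2
  rw [Pi.sub_apply]
  omega

theorem innerBox_anti {d m m' L : ℕ} (h : m ≤ m') : innerBox d m' L ⊆ innerBox d m L :=
  fun u hu i => by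
    have := mem_innerBox.1 hu i
    beta_reduce
    omega

/-! ### Passage to the limit -/

/-- A free action admits codings of partial tilings which almost surely stabilize, and which start
with large dominoes and never change off a set of small measure. -/
theorem exists_stabilizing_codings {d k : ℕ} {w : Fin k → Fin d → ℕ} (hw : ∀ j i, 0 < w j i)
    (hgcd : ∀ i, Finset.univ.gcd (fun j => w j i) = 1)
    {X : Type*} [MeasurableSpace X] {μ : Measure X} [IsProbabilityMeasure μ]
    (hμ : IsLebesgueSpace μ) [AddAction (Fin d → ℤ) X]
    (hT : ∀ v : Fin d → ℤ, MeasurePreserving (fun x : X => v +ᵥ x) μ μ)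
    (hfree : ∀ v : Fin d → ℤ, v ≠ 0 → ∀ᵐ x ∂μ, v +ᵥ x ≠ x) {δ : ℝ} (hδ : 0 < δ) :
    ∃ (ψ : ℕ → X → DominoAlphabet w) (bad : ℕ → Set X),
      (∀ n a, MeasurableSet (ψ n ⁻¹' {a})) ∧
      (∀ x, (ψ 0 x).1 = none) ∧
      (∀ n x, x ∉ bad n → x ∉ bad (n + 1) → ψ (n + 1) x = ψ n x) ∧
      (∀ n x, x ∉ bad n → ∀ (t : Option (Fin k)) (v : rectangle (dominoSides w t)),
        ψ n x = ⟨t, v⟩ → ∀ v' : rectangle (dominoSides w t),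
          ψ n (((v' : Fin d → ℤ) - v) +ᵥ x) = ⟨t, v'⟩) ∧
      ∑' n, μ (bad n) < ENNReal.ofReal δ := by
  have hQ := commonSide_pos hw
  obtain ⟨K, hK⟩ := exists_forall_ge_mem_closure w hgcd
  obtain ⟨ε, hε, hεsum⟩ := ENNReal.exists_pos_sum_of_countable
    (ENNReal.ofReal_pos.2 hδ).ne' ℕ
  set Q := commonSide w with hQdef
  -- Divisible by `Q`, so that inner boxes are aligned, and at least `Q + K`: alignment may cost up
  -- to `Q`, which leaves frames of width `K`.
  set m := Q * (K + 1) with hmdef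
  have hmK : Q + K ≤ m := by
    have := Nat.le_mul_of_pos_left K hQ
    rw [hmdef, mul_add, mul_one]
    omega
  choose side hdvd hle base hbm hbase hbμ using fun (M n : ℕ) =>
    exists_towerBase_inner hμ hT hfree hQ M (δ := ε n) (by exact_mod_cast hε n)
  -- The margin `m + L n` in the next tower guarantees that the old cube around a good point is
  -- absorbed whole. Tower 0 is empty; its side `2 * m` only has to meet the divisibility and size
  -- conditions.
  let L : ℕ → ℕ := fun n => Nat.rec (2 * m) (fun n l => side (m + l) n) n
  let B : ℕ → Set X := fun n => Nat.casesOn n ∅ fun n => base (m + L n) n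
  have hBm : ∀ n, MeasurableSet (B n) := fun n => by
    cases n with
    | zero => exact MeasurableSet.empty
    | succ n => exact hbm _ _
  have hB : ∀ n, IsTowerBase d (L n) (B n) := fun n => by
    cases n with
    | zero => exact fun x hx => hx.elim
    | succ n => exact hbase _ _
  have hLQ : ∀ n, Q ∣ L n := fun n => by
    cases n with
    | zero => exact (Dvd.intro _ rfl : Q ∣ m).mul_left 2
    | succ n => exact hdvd _ _
  have hLm : ∀ n, 2 * m ≤ L n := fun n => by
    cases n with
    | zero => exact le_rfl
    | succ n => exact le_trans (by omega) (hle (m + L n) n)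
  choose g hg using fun n => exists_frame_tilings hw hK (Dvd.intro _ rfl) hmK (hLQ n) (hLm n)
  let ψ : ℕ → X → DominoAlphabet w := fun n => Nat.rec (fun _ => gridSymbol hw none 0)
    (fun n φ x => refineSymbol hw (g n) m (L n) (L (n + 1)) (φ x) (towerPos (L n) (B n) x)
      (towerPos (L (n + 1)) (B (n + 1)) x)) n
  have hψ : ∀ n x, ψ (n + 1) x = refineSymbol hw (g n) m (L n) (L (n + 1)) (ψ n x)
      (towerPos (L n) (B n) x) (towerPos (L (n + 1)) (B (n + 1)) x) := fun _ _ => rfl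
  have hψm : ∀ n a, MeasurableSet (ψ n ⁻¹' {a}) := fun n => by
    induction n with
    | zero => exact fun a => MeasurableSet.const (gridSymbol hw none 0 = a)
    | succ n ih =>
      exact fun a => measurableSet_preimage_of_countable ih
        (measurableSet_towerPos_preimage hT (hBm n) (hB n))
        (measurableSet_towerPos_preimage hT (hBm (n + 1)) (hB (n + 1)))
        fun s o o' => refineSymbol hw (g n) m (L n) (L (n + 1)) s o o' = a
  have hcod : ∀ n, IsCodingOnTower m (L n) (B n) (ψ n) := fun n => by
    induction n with
    | zero =>
      intro x u hu
      change towerPos (2 * m) ∅ x = some u at hu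
      simp [towerPos_empty] at hu
    | succ n ih =>
      exact ih.refine hw (hB n) (hB (n + 1)) (Dvd.intro _ rfl) (by omega) (hLQ n) (hLQ (n + 1))
        (hg n)
  let bad : ℕ → Set X := fun n => {x | ¬ ∃ u : Fin d → ℤ,
    (∀ i, ((m + L n : ℕ) : ℤ) ≤ u i ∧ u i < (L (n + 1) : ℤ) - (m + L n : ℕ)) ∧ -u +ᵥ x ∈ B (n + 1)}
  have hbad : ∀ n x, x ∉ bad n → ∃ u, towerPos (L (n + 1)) (B (n + 1)) x = some u ∧
      u ∈ innerBox d (m + L n) (L (n + 1)) := fun n x hx => by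
    obtain ⟨u, hu, hux⟩ := not_not.1 hx
    have hu' : u ∈ innerBox d (m + L n) (L (n + 1)) := hu
    exact ⟨u, (towerPos_eq_some_iff (hB (n + 1))).2 ⟨innerBox_subset_latticeCube hu', hux⟩, hu'⟩
  -- The index is shifted because the first nonempty tower can only be number 1, and `bad n` refers
  -- to tower `n + 1`.
  refine ⟨fun n => ψ (n + 1), bad, fun n => hψm (n + 1), fun x => ?_, fun n x h1 h2 => ?_,
    fun n x hx t v hv v' => ?_, ?_⟩
  · change (refineSymbol hw (g 0) m _ _ _ (towerPos (2 * m) ∅ x) _).1 = none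
    rw [towerPos_empty]
    cases towerPos (d := d) (L 1) (B 1) x <;> rfl
  · obtain ⟨u, hu, hui⟩ := hbad n x h1
    obtain ⟨q, hq, hqi⟩ := hbad (n + 1) x h2
    beta_reduce
    rw [hψ (n + 1), hu, hq]
    exact refineSymbol_eq_of_inner hw _ (by omega) _ (innerBox_anti (by omega) hui) hqi
  · obtain ⟨u, hu, hui⟩ := hbad n x hx
    exact (hcod (n + 1) x u hu (innerBox_anti (by omega) hui) t v hv v').2
  · refine lt_of_le_of_lt (ENNReal.tsum_le_tsum fun n => ?_) hεsum
    have := hbμ (m + L n) n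
    rw [measureReal_def] at this
    rw [← ENNReal.ofReal_toReal (measure_ne_top μ (bad n)), ← ENNReal.ofReal_coe_nnreal]
    exact ENNReal.ofReal_le_ofReal this

/-- By Borel–Cantelli almost every point has all its translates in only finitely many bad sets. Each
tiling condition relates two positions, so it is inherited from one late stage at which both symbols
have settled. Off the union of the bad sets the initial large domino survives. -/
theorem exists_coding_of_small_error {d k : ℕ} {w : Fin k → Fin d → ℕ} (hw : ∀ j i, 0 < w j i)
    (hgcd : ∀ i, Finset.univ.gcd (fun j => w j i) = 1)
    {X : Type*} [MeasurableSpace X] {μ : Measure X} [IsProbabilityMeasure μ]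
    (hμ : IsLebesgueSpace μ) [AddAction (Fin d → ℤ) X]
    (hT : ∀ v : Fin d → ℤ, MeasurePreserving (fun x : X => v +ᵥ x) μ μ)
    (hfree : ∀ v : Fin d → ℤ, v ≠ 0 → ∀ᵐ x ∂μ, v +ᵥ x ≠ x) {δ : ℝ} (hδ : 0 < δ) :
    ∃ φ : X → DominoAlphabet w,
      (∀ a, MeasurableSet (φ ⁻¹' {a})) ∧
      (∀ᵐ x ∂μ, ∃ y ∈ dominoShift w, ∀ v : Fin d → ℤ, φ (v +ᵥ x) = y v) ∧
      μ.real {x | (φ x).1 ≠ none} < δ := by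
  obtain ⟨ψ, bad, hψm, hψ0, hstep, hcod, hsum⟩ :=
    exists_stabilizing_codings hw hgcd hμ hT hfree hδ
  obtain ⟨φ, hφm, hφ⟩ := exists_measurable_eventual_value (gridSymbol hw none 0) hψm
  have hstable : ∀ x N, (∀ n ≥ N, x ∉ bad n) → ∀ n ≥ N, ψ n x = ψ N x := fun x N hN n hn => by
    induction n, hn using Nat.le_induction with
    | base => rfl
    | succ n hn ih => rw [hstep n x (hN n hn) (hN (n + 1) (by omega)), ih]
  have hev : ∀ x, (∀ᶠ n in Filter.atTop, x ∉ bad n) →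
      ∀ᶠ n in Filter.atTop, ψ n x = φ x := fun x hx => by
    obtain ⟨N, hN⟩ := Filter.eventually_atTop.1 hx
    have h : ∀ᶠ n in Filter.atTop, ψ n x = ψ N x :=
      Filter.eventually_atTop.2 ⟨N, hstable x N hN⟩
    rwa [hφ x _ h]
  have hae : ∀ᵐ x ∂μ, ∀ v : Fin d → ℤ, ∀ᶠ n in Filter.atTop, v +ᵥ x ∉ bad n :=
    ae_all_iff.2 fun v => (hT v).quasiMeasurePreserving.ae
      (ae_eventually_notMem (hsum.trans_le le_top).ne)
  refine ⟨φ, hφm, ?_, ?_⟩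
  · filter_upwards [hae] with x hx
    refine ⟨fun v => φ (v +ᵥ x), fun u t v huv v' => ?_, fun v => rfl⟩
    have hw' : u - (v : Fin d → ℤ) + (v' : Fin d → ℤ) = (v' - v) + u := by abel
    beta_reduce
    rw [hw', ← vadd_vadd]
    obtain ⟨n, ⟨h1, h2⟩, h3⟩ := (((hx u).and (hev _ (hx u))).and
      (hev _ (hx ((v' - v) + u)))).exists
    rw [← vadd_vadd] at h3
    rw [← h3]
    exact hcod n _ h1 t v (h2.trans huv) v'
  · have hsub : {x | (φ x).1 ≠ none} ⊆ ⋃ n, bad n := fun x hx => by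
      by_contra h
      rw [Set.mem_iUnion, not_exists] at h
      have h1 : φ x = ψ 0 x := hφ x _ (Filter.eventually_atTop.2
        ⟨0, hstable x 0 fun n _ => h n⟩)
      exact hx (h1 ▸ hψ0 x)
    have hlt : μ {x | (φ x).1 ≠ none} < ENNReal.ofReal δ :=
      ((measure_mono hsub).trans (measure_iUnion_le _)).trans_lt hsum
    exact (ENNReal.toReal_lt_toReal (measure_ne_top _ _) ENNReal.ofReal_ne_top).2 hlt |>.trans_eq
      (ENNReal.toReal_ofReal hδ.le)

theorem theorem2 {d k : ℕ} (hk : 2 ≤ k)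
    -- the side vectors are positive and have coordinatewise gcd 1
    (w : Fin k → Fin d → ℕ) (hw : ∀ j i, 0 < w j i)
    (hgcd : ∀ i, Finset.univ.gcd (fun j => w j i) = 1)
    -- the prescribed distribution
    (p : Fin k → ℝ) (hp : ∀ j, 0 < p j) (hp_sum : ∑ j, p j = 1)
    -- a free measure-preserving action of `ℤ^d` on a Lebesgue probability space
    {X : Type*} [MeasurableSpace X] (μ : Measure X) [IsProbabilityMeasure μ]
    (hμ : IsLebesgueSpace μ) [AddAction (Fin d → ℤ) X]
    (hT : ∀ v : Fin d → ℤ, MeasurePreserving (fun x : X => v +ᵥ x) μ μ)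
    (hfree : ∀ v : Fin d → ℤ, v ≠ 0 → ∀ᵐ x ∂μ, v +ᵥ x ≠ x) :
    ∃ φ : X → DominoAlphabet w,
      (∀ a, MeasurableSet (φ ⁻¹' {a})) ∧
      (∀ᵐ x ∂μ, ∃ y ∈ dominoShift w, ∀ v : Fin d → ℤ, φ (v +ᵥ x) = y v) ∧
      -- each small domino covers less than `min_i p_i`
      (∀ j i, μ.real {x | (φ x).1 = some j} < p i) ∧
      -- the large domino covers more than `1 - min_i p_i`
      (∀ i, 1 - p i < μ.real {x | (φ x).1 = none}) := by
  have : Nonempty (Fin k) := ⟨⟨0, by omega⟩⟩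
  -- With error bound `p i₀`, all small dominoes together cover less than the least `p i`.
  obtain ⟨i₀, hi₀⟩ := Finite.exists_min p
  obtain ⟨φ, hφm, hφY, hφδ⟩ := exists_coding_of_small_error hw hgcd hμ hT hfree (hp i₀)
  refine ⟨φ, hφm, hφY, fun j i => ?_, fun i => ?_⟩
  · refine (measureReal_mono fun x hx => ?_).trans_lt (hφδ.trans_le (hi₀ i))
    exact fun h => Option.some_ne_none j (hx.symm.trans h)
  · have hm : MeasurableSet {x | (φ x).1 = none} :=
      measurableSet_preimage_of_countable hφm hφm hφm fun a _ _ => a.1 = none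
    have h := probReal_compl_eq_one_sub (μ := μ) hm
    have h' : {x | (φ x).1 = none}ᶜ = {x | (φ x).1 ≠ none} := rfl
    rw [h'] at h
    have := hi₀ i
    linarith
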